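/- **Setting.** Let $X\subset\mathbb R$ be a non-empty countable set of alternatives and $N$ a finite set of agents, partitioned into $A$ and $D=N\setminus A$ (either may be empty). A preference $R_i$ is a complete, transitive, antisymmetric relation on $X$, with strict part $P_i$. It is single-peaked if for some $\rho\in X$: $x\,P_i\,y$ whenever $\rho\ge x>y$ or $\rho\le x<y$. It is single-dipped if for some $\delta\in X$: $y\,P_i\,x$ whenever $\delta\ge x>y$ or $\delta\le x<y$. Let $\mathcal R_i$ be the set of all single-peaked preferences if $i\in A$, and of all single-dipped preferences if $i\in D$, and let $\mathcal R=\prod_{i\in N}\mathcal R_i$. A rule is a map $f:\mathcal R\to X$; let $\Omega$ be its range. A group $S\subseteq N$ manipulates $f$ if there are $R\in\mathcal R$ and $R'_S\in\prod_{i\in S}\mathcal R_i$ with $f(R'_S,R_{-S})\,P_i\,f(R)$ for all $i\in S$. The rule $f$ is strategy-proof (SP) if no single agent manipulates it, and group strategy-proof (GSP) if no non-empty group does. For $i\in A$, the $\Omega$-restricted peak $p(R_i)$ is the element of $\Omega$ that $R_i$ strictly prefers to all other elements of $\Omega$ (if it exists); $p(R)=(p(R_i))_{i\in A}$. Let $\Omega^2_C$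 be the set of pairs $(x,y)$ with $x,y\in\Omega$, $x<y$ and no element of $\Omega$ strictly between $x$ and $y$. Order $\Omega\cup\Omega^2_C$ linearly by $<^*$, which extends $<$ on $\Omega$ and satisfies $x<^*(x,y)<^*y$ for $(x,y)\in\Omega^2_C$. Let $\mathrm{int}(\Omega)$ be $\Omega$ without its minimum and its maximum (where they exist). *Left coalition system.* For $r\subseteq\Omega\cup\Omega^2_C$ with $\mathrm{int}(\Omega)\subseteq r$, a left coalition system on $r$ assigns to each $\alpha\in r$ a family $\mathcal L(\alpha)$ of subsets of $A$ such that: (a) if $C\in\mathcal L(\alpha)$ and $C\subseteq C'\subseteq A$ then $C'\in\mathcal L(\alpha)$; (b) if $\alpha<^*\beta$ then $\mathcal L(\alpha)\subseteq\mathcal L(\beta)$; (c) if $\max\Omega$ exists and $\max\Omega\notin r$, then $r$ has a $<^*$-maximum $\max r$, $\emptyset\in\mathcal L(\max r)$, and $\emptyset\notin\mathcal L(\alpha)$ for all $\alpha\in r\setminus\{\max r\}$; (d) if $\max\Omega$ does not exist, then $\emptyset\notin\mathcal L(\alpha)$ for all $\alpha\in r$. Put $\mathcal L(x)=\emptyset$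 for $x\in\Omega\setminus r$. *Generalized median voter function.* A function $\omega:\Omega^A\to\Omega\cup\Omega^2_C$ with range $r_\omega$ is a generalized median voter function on $r_\omega$ associated with a left coalition system $\mathcal L$ on $r_\omega$ if for all $\mathbf p\in\Omega^A$ and $\alpha\in r_\omega$: $\omega(\mathbf p)=\alpha$ if and only if $\{i\in A:\mathbf p_i\le^*\alpha\}\in\mathcal L(\alpha)$ and $\{i\in A:\mathbf p_i\le^*\beta\}\notin\mathcal L(\beta)$ for every $\beta\in r_\omega$ with $\beta<^*\alpha$. *Voting by collections of left-decisive sets.* Given such $\omega$ and $\mathcal L$ and a pair $(x,y)\in r_\omega\cap\Omega^2_C$, a function $g_{(x,y)}:\mathcal R\to\{x,y\}$ is a voting by collections of left-decisive sets if there is a family $W$ of subsets of $N$, none of which is a proper subset of another, such that: for each $R\in\mathcal R$ with $\omega(p(R))=(x,y)$, $g_{(x,y)}(R)=x$ if $C\subseteq\{i\in N: x\,P_i\,y\}$ for some $C\in W$, and $g_{(x,y)}(R)=y$ otherwise; $C\cap D\ne\emptyset$ for each $C\in W$; and for each inclusion-minimal element $B$ of $\mathcal L((x,y))\setminus\mathcal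 L(x)$ there is $C\in W$ with $C\cap A=B$. **Theorem.** For every rule $f:\mathcal R\to X$ with range $\Omega$ the following statements are equivalent: (i) $f$ is SP. (ii) $f$ is GSP. (iii) There are a generalized median voter function $\omega$ on a set $r_\omega$ with $\mathrm{int}(\Omega)\subseteq r_\omega\subseteq\Omega\cup\Omega^2_C$, associated with a left coalition system $\mathcal L$, and for each $(x,y)\in r_\omega\cap\Omega^2_C$ a voting by collections of left-decisive sets $g_{(x,y)}$, such that for each $R\in\mathcal R$ the vector $p(R)\in\Omega^A$ exists and $$f(R)=\begin{cases}\omega(p(R)) & \text{if }\omega(p(R))\in\Omega,\\ g_{\omega(p(R))}(R) & \text{if }\omega(p(R))\in\Omega^2_C.\end{cases}$$ -/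

import Mathlib

/-- A preference over `α`: a complete, transitive and antisymmetric binary relation,
`R.rel x y` meaning that `x` is weakly preferred to `y`. -/
structure Pref (α : Type*) where
  rel : α → α → Prop
  complete : ∀ x y, rel x y ∨ rel y x
  transitive : ∀ x y z, rel x y → rel y z → rel x z
  antisymmetric : ∀ x y, rel x y → rel y x → x = y

/-- Strict preference. -/
def Pref.strict {α : Type*} (R : Pref α) (x y : α) : Prop :=
  R.rel x y ∧ ¬ R.rel y x

/-- `R` is single-peaked: it has a peak `ρ`, and alternatives get worse when moving away from `ρ`
to either side. -/
def SinglePeaked {α : Type*} [LinearOrder α] (R : Pref α) : Prop :=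
  ∃ ρ : α, ∀ x y : α, (x ≤ ρ ∧ y < x) ∨ (ρ ≤ x ∧ x < y) → R.strict x y

/-- `R` is single-dipped: it has a dip `δ`, and alternatives get better when moving away from `δ`
to either side. -/
def SingleDipped {α : Type*} [LinearOrder α] (R : Pref α) : Prop :=
  ∃ δ : α, ∀ x y : α, (x ≤ δ ∧ y < x) ∨ (δ ≤ x ∧ x < y) → R.strict y x

/-- The preference domain of agent `i`: all single-peaked preferences if `i ∈ A`,
all single-dipped preferences if `i ∉ A`, i.e. if `i ∈ D`. -/
def PrefDomain (α : Type*) [LinearOrder α] {N : Type*} (A : Set N) (i : N) : Type _ :=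
  {R : Pref α // (i ∈ A → SinglePeaked R) ∧ (i ∉ A → SingleDipped R)}

/-- Preference profiles. -/
abbrev Profile (α : Type*) [LinearOrder α] {N : Type*} (A : Set N) : Type _ :=
  (i : N) → PrefDomain α A i

/-- The rule `f` is manipulable by the group `S`: at some profile `R` the members of `S` can jointly
change their preferences so that each of them strictly (according to `R`) gains. -/
def ManipulableBy {α : Type*} [LinearOrder α] {N : Type*} {A : Set N}
    (f : Profile α A → α) (S : Set N) : Prop :=
  ∃ R R' : Profile α A, (∀ i, i ∉ S → R' i = R i) ∧ ∀ i ∈ S, (R i).1.strict (f R') (f R)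

/-- Strategy-proofness. -/
def StrategyProof {α : Type*} [LinearOrder α] {N : Type*} {A : Set N}
    (f : Profile α A → α) : Prop :=
  ∀ i : N, ¬ ManipulableBy f {i}

/-- Group strategy-proofness: no non-empty group can manipulate. -/
def GroupStrategyProof {α : Type*} [LinearOrder α] {N : Type*} {A : Set N}
    (f : Profile α A → α) : Prop :=
  ∀ S : Set N, S.Nonempty → ¬ ManipulableBy f S

/-- Possible outcomes of the first step: one alternative, or an ordered pair of alternatives. -/
inductive Presel (α : Type*) where
  | single (x : α) : Presel α
  | pair (x y : α) : Presel α

/-- The set `Ω ∪ Ω²_C`: the elements of `Ω` together with the pairs `(x, y)` of contiguous elements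
`x < y` of `Ω`. -/
def preselections {α : Type*} [LinearOrder α] (Ω : Set α) : Set (Presel α) :=
  {β | (∃ x ∈ Ω, β = .single x) ∨
    ∃ x ∈ Ω, ∃ y ∈ Ω, x < y ∧ (∀ z ∈ Ω, ¬ (x < z ∧ z < y)) ∧ β = .pair x y}

/-- The order `<*`, which extends the order of the alternatives by `x <* (x, y) <* y`
(meaningful on the sets `preselections Ω`, on which it is a strict linear order). -/
def ltStar {α : Type*} [LinearOrder α] : Presel α → Presel α → Prop
  | .single x, .single y => x < y
  | .single z, .pair x _ => z ≤ x
  | .pair _ y, .single z => y ≤ z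
  | .pair _ y, .pair z _ => y ≤ z

/-- The order `≤*`. -/
def leStar {α : Type*} [LinearOrder α] (β γ : Presel α) : Prop :=
  β = γ ∨ ltStar β γ

/-- The interior of `Ω`: all its elements except its minimum and its maximum (where they exist). -/
def interiorPoints {α : Type*} [LinearOrder α] (Ω : Set α) : Set α :=
  {x ∈ Ω | ¬ IsLeast Ω x ∧ ¬ IsGreatest Ω x}

/-- `p` is the vector of `Ω`-restricted peaks at `R`: for each `i ∈ A`, `p i` is the element of `Ω`
that agent `i` strictly prefers to all other elements of `Ω`. -/
def IsPeakVector {α : Type*} [LinearOrder α] {N : Type*} {A : Set N} {Ω : Set α}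
    (R : Profile α A) (p : A → Ω) : Prop :=
  ∀ i : A, ∀ y ∈ Ω, y ≠ (p i : α) → (R i).1.strict (p i) y

/-- The coalition of those agents of `A` whose peak is `≤* β`. -/
def leftCoalition {α : Type*} [LinearOrder α] {N : Type*} {A : Set N} {Ω : Set α}
    (p : A → Ω) (β : Presel α) : Set A :=
  {i | leStar (.single (p i : α)) β}

/-- `L` is a left coalition system on `r`; it is set to be empty outside of `r`. -/
structure IsLeftCoalitionSystem {α : Type*} [LinearOrder α] {N : Type*} {A : Set N}
    (Ω : Set α) (r : Set (Presel α)) (L : Presel α → Set (Set A)) : Prop where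
  outside : ∀ β, β ∉ r → L β = ∅
  superset : ∀ β ∈ r, ∀ C ∈ L β, ∀ C', C ⊆ C' → C' ∈ L β
  mono : ∀ β ∈ r, ∀ γ ∈ r, ltStar β γ → ∀ C ∈ L β, C ∈ L γ
  max_not_mem : ∀ M, IsGreatest Ω M → .single M ∉ r →
    ∃ m ∈ r, (∀ β ∈ r, leStar β m) ∧ ∅ ∈ L m ∧ ∀ β ∈ r, β ≠ m → ∅ ∉ L β
  no_max : (¬ ∃ M, IsGreatest Ω M) → ∀ β ∈ r, ∅ ∉ L β

/-- `ω` is the generalized median voter function on `r` associated with `L`: `ω p` is the first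
element `β` of `r` such that the agents with a peak `≤* β` form a coalition of `L β`. -/
def IsGeneralizedMedian {α : Type*} [LinearOrder α] {N : Type*} {A : Set N} {Ω : Set α}
    (r : Set (Presel α)) (L : Presel α → Set (Set A)) (ω : (A → Ω) → Presel α) : Prop :=
  ∀ p : A → Ω, ∀ β ∈ r, ω p = β ↔
    leftCoalition p β ∈ L β ∧ ∀ γ ∈ r, ltStar γ β → leftCoalition p γ ∉ L γ

/-- The set of agents (of both types) who strictly prefer `x` to `y` at `R`. -/
def supporters {α : Type*} [LinearOrder α] {N : Type*} {A : Set N}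
    (R : Profile α A) (x y : α) : Set N :=
  {i | (R i).1.strict x y}

/-- The binary decision function `g` for the preselected pair `(x, y)` is a voting by collections of
left-decisive sets, `W` being the minimal set of left-decisive coalitions. -/
def IsLeftDecisiveVoting {α : Type*} [LinearOrder α] {N : Type*} {A : Set N} {Ω : Set α}
    (L : Presel α → Set (Set A)) (ω : (A → Ω) → Presel α) (x y : α)
    (g : Profile α A → α) : Prop :=
  ∃ W : Set (Set N),
    (∀ C ∈ W, Minimal (· ∈ W) C) ∧
    (∀ (R : Profile α A) (p : A → Ω), IsPeakVector R p → ω p = .pair x y →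
      ((∃ C ∈ W, C ⊆ supporters R x y) → g R = x) ∧
      ((¬ ∃ C ∈ W, C ⊆ supporters R x y) → g R = y)) ∧
    (∀ C ∈ W, (C ∩ Aᶜ).Nonempty) ∧
    (∀ B : Set A, Minimal (· ∈ L (.pair x y) \ L (.single x)) B →
      ∃ C ∈ W, C ∩ A = Subtype.val '' B)

/-- `f`, whose range is `Ω`, is a two-step rule. First a generalized median voter function `ω`, with
range `r` satisfying `int Ω ⊆ r ⊆ Ω ∪ Ω²_C`, is applied to the `Ω`-restricted peaks of the agents
in `A` (in particular, these peaks exist). Then, if a pair is preselected, a voting by collections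
of left-decisive sets chooses between its two elements. -/
def IsTwoStepRule {α : Type*} [LinearOrder α] {N : Type*} {A : Set N}
    (f : Profile α A → α) : Prop :=
  ∃ (ω : (A → Set.range f) → Presel α) (r : Set (Presel α)) (L : Presel α → Set (Set A))
    (g : Presel α → Profile α A → α),
    r = Set.range ω ∧
    Presel.single '' interiorPoints (Set.range f) ⊆ r ∧ r ⊆ preselections (Set.range f) ∧
    IsLeftCoalitionSystem (Set.range f) r L ∧
    IsGeneralizedMedian r L ω ∧
    (∀ x y, .pair x y ∈ r →
      (∀ R, g (.pair x y) R = x ∨ g (.pair x y) R = y) ∧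
      IsLeftDecisiveVoting L ω x y (g (.pair x y))) ∧
    ∀ R : Profile α A, ∃ p : A → Set.range f, IsPeakVector R p ∧
      (∀ x, ω p = .single x → f R = x) ∧
      (∀ x y, ω p = .pair x y → f R = g (.pair x y) R)

/-! ### Single-peaked and single-dipped preferences and their extreme representatives. -/

section Preferences

variable {α : Type*}

/-! From strategy-proofness to the two-step form, everything rests on the options of `D`: the
outcomes its agents can still bring about once the reports of `A` are fixed. Splitting `D` into two
blocs by the position of their dips and playing the blocs against each other shows that there are at
most two options (`not_three_options`). Two options have no element z of the range strictly between
them (`options_contiguous`): otherwise the agents of `A` can be moved one by one to the peak z with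
options remaining on both sides of z, and once all peaks are at z, z is a third option.

A similar migration shows that an agent of `A` matters only through the peak on the range
(`peak_only`). Its preference may thus be replaced by `peakLeft` or `peakRight`, which makes the
outcome monotone in the peaks (`le_of_peaks`). So a peak vector determines a single outcome or a
contiguous pair (`Preselects`). Monotonicity turns this map into a generalized median, with
`forcingCoalitions` as left coalition system. Inside a pair the choice is monotone in the set of
supporters of the left element, hence described by the minimal winning sets.

Conversely, in a two-step rule a shift of the preselection in either direction requires a changed
peak of someone who does not gain from that shift, and inside an unchanged pair the monotone vote
cannot turn in favour of the manipulators. This gives group strategy-proofness, which contains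
strategy-proofness. -/

theorem Pref.refl (R : Pref α) (x : α) : R.rel x x := (R.complete x x).elim id id

theorem Pref.rel_of_not_strict (R : Pref α) {x y : α} (h : ¬ R.strict x y) : R.rel y x := by
  by_contra hn
  exact h ⟨(R.complete x y).resolve_right hn, hn⟩

theorem Pref.strict_or_eq (R : Pref α) {x y : α} (h : R.rel x y) : R.strict x y ∨ x = y := by
  by_cases hyx : R.rel y x
  · exact .inr (R.antisymmetric _ _ h hyx)
  · exact .inl ⟨h, hyx⟩

theorem Pref.strict_of_rel_of_ne (R : Pref α) {x y : α} (h : R.rel x y) (hne : x ≠ y) :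
    R.strict x y := (R.strict_or_eq h).resolve_right hne

theorem Pref.strict.ne {R : Pref α} {x y : α} (h : R.strict x y) : x ≠ y := by
  rintro rfl
  exact h.2 h.1

theorem Pref.strict.trans {R : Pref α} {x y z : α} (h : R.strict x y) (h' : R.strict y z) :
    R.strict x z :=
  ⟨R.transitive _ _ _ h.1 h'.1, fun hn => h.2 (R.transitive _ _ _ h'.1 hn)⟩

theorem Pref.strict.asymm {R : Pref α} {x y : α} (h : R.strict x y) : ¬ R.strict y x :=
  fun h' => h.2 h'.1

/-- The reversed preference. -/
def Pref.reverse (R : Pref α) : Pref α where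
  rel x y := R.rel y x
  complete x y := R.complete y x
  transitive _ _ _ h h' := R.transitive _ _ _ h' h
  antisymmetric _ _ h h' := R.antisymmetric _ _ h' h

variable [LinearOrder α]

/-- The preference with peak `ρ` ranking everything up to `ρ` above everything beyond. -/
def peakLeft (ρ : α) : Pref α where
  rel x y := (y ≤ x ∧ x ≤ ρ) ∨ (x ≤ ρ ∧ ρ < y) ∨ (ρ < x ∧ x ≤ y)
  complete x y := by grind
  transitive x y z := by grind
  antisymmetric x y := by grind

/-- The preference with peak `ρ` ranking everything from `ρ` on above everything before. -/
def peakRight (ρ : α) : Pref α where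
  rel x y := (x ≤ y ∧ ρ ≤ x) ∨ (ρ ≤ x ∧ y < ρ) ∨ (x < ρ ∧ y ≤ x)
  complete x y := by grind
  transitive x y z := by grind
  antisymmetric x y := by grind

/-- The preference with dip `δ` ranking everything before `δ` above everything from `δ` on. -/
def dipLeft (δ : α) : Pref α := (peakRight δ).reverse

/-- The preference with dip `δ` ranking everything beyond `δ` above everything up to `δ`. -/
def dipRight (δ : α) : Pref α := (peakLeft δ).reverse

theorem peakLeft_rel {ρ x y : α} : (peakLeft ρ).rel x y ↔
    (y ≤ x ∧ x ≤ ρ) ∨ (x ≤ ρ ∧ ρ < y) ∨ (ρ < x ∧ x ≤ y) := Iff.rfl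

theorem peakRight_rel {ρ x y : α} : (peakRight ρ).rel x y ↔
    (x ≤ y ∧ ρ ≤ x) ∨ (ρ ≤ x ∧ y < ρ) ∨ (x < ρ ∧ y ≤ x) := Iff.rfl

theorem dipLeft_rel {δ x y : α} : (dipLeft δ).rel x y ↔
    (y ≤ x ∧ δ ≤ y) ∨ (δ ≤ y ∧ x < δ) ∨ (y < δ ∧ x ≤ y) := Iff.rfl

theorem dipRight_rel {δ x y : α} : (dipRight δ).rel x y ↔
    (x ≤ y ∧ y ≤ δ) ∨ (y ≤ δ ∧ δ < x) ∨ (δ < y ∧ y ≤ x) := Iff.rfl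

theorem singlePeaked_peakLeft (ρ : α) : SinglePeaked (peakLeft ρ) :=
  ⟨ρ, fun x y => by simp only [Pref.strict, peakLeft_rel]; grind⟩

theorem singlePeaked_peakRight (ρ : α) : SinglePeaked (peakRight ρ) :=
  ⟨ρ, fun x y => by simp only [Pref.strict, peakRight_rel]; grind⟩

theorem singleDipped_dipLeft (δ : α) : SingleDipped (dipLeft δ) :=
  ⟨δ, fun x y => by simp only [Pref.strict, dipLeft_rel]; grind⟩

theorem singleDipped_dipRight (δ : α) : SingleDipped (dipRight δ) :=
  ⟨δ, fun x y => by simp only [Pref.strict, dipRight_rel]; grind⟩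

/-- `z` is strictly preferred to all other elements of `Ω`. -/
def Pref.HasPeakOn (P : Pref α) (Ω : Set α) (z : α) : Prop :=
  ∀ y ∈ Ω, y ≠ z → P.strict z y

theorem peakLeft_hasPeakOn (Ω : Set α) (z : α) : (peakLeft z).HasPeakOn Ω z := by
  intro y _ hy
  simp only [Pref.strict, peakLeft_rel]
  grind

theorem peakRight_hasPeakOn (Ω : Set α) (z : α) : (peakRight z).HasPeakOn Ω z := by
  intro y _ hy
  simp only [Pref.strict, peakRight_rel]
  grind

/-- The peak ρ over all alternatives may lie outside Ω. For x ≠ z it still cannot lie at x or beyond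
it as seen from z, since x would then beat z; so the preference already falls from x to y. -/
theorem SinglePeaked.strict_of_hasPeakOn {P : Pref α} (hP : SinglePeaked P) {Ω : Set α} {z x y : α}
    (hz : z ∈ Ω) (hx : x ∈ Ω) (hy : y ∈ Ω) (h : P.HasPeakOn Ω z)
    (hxy : (z ≤ x ∧ x < y) ∨ (x ≤ z ∧ y < x)) : P.strict x y := by
  obtain ⟨ρ, hρ⟩ := hP
  rcases eq_or_ne x z with rfl | hxz
  · exact h y hy (by grind)
  · have h1 := (h x hx hxz).2
    have h2 := hρ x z
    have h3 := hρ x y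
    have h4 : P.strict x z → P.rel x z := fun h => h.1
    grind

/-- Either w is past the peak and the preference falls towards y, or w is still climbing and is at
least as good as x. -/
theorem SinglePeaked.strict_of_mem_Ico {P : Pref α} (hP : SinglePeaked P) {x y w : α}
    (hxy : P.strict x y) (h1 : x ≤ w) (h2 : w < y) : P.strict w y := by
  obtain ⟨ρ, hρ⟩ := hP
  rcases le_total ρ w with h | h
  · exact hρ w y (.inr ⟨h, h2⟩)
  · rcases eq_or_lt_of_le h1 with rfl | h1
    · exact hxy
    · exact (hρ w x (.inl ⟨h, h1⟩)).trans hxy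

end Preferences

/-! ### Consequences of strategy-proofness for groups, and the bound on the options of `D`. -/

section Profiles

variable {α : Type*} [LinearOrder α] {N : Type*} {A : Set N}

open Classical in
/-- The profile in which the members of `T` follow `R'` and the others follow `R`. -/
noncomputable def mix (T : Set N) (R' R : Profile α A) : Profile α A :=
  fun i => if i ∈ T then R' i else R i

theorem mix_of_mem {T : Set N} {R' R : Profile α A} {i : N} (h : i ∈ T) : mix T R' R i = R' i :=
  if_pos h

theorem mix_of_notMem {T : Set N} {R' R : Profile α A} {i : N} (h : i ∉ T) :
    mix T R' R i = R i := if_neg h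

/-- Walking from `R` to `R'` by changing one agent at a time. -/
theorem profile_walk [Finite N] {motive : Profile α A → Prop} {R R' : Profile α A}
    (start : motive R)
    (step : ∀ (Q Q' : Profile α A) (j : N), motive Q → (∀ i, i ≠ j → Q' i = Q i) → Q j = R j →
      Q' j = R' j → motive Q') : motive R' := by
  have key : ∀ T : Set N, motive (mix T R' R) := by
    intro T
    refine Set.Finite.induction_on (motive := fun T _ => motive (mix T R' R)) T (Set.toFinite T) ?_ ?_
    · have : mix ∅ R' R = R := funext fun i => mix_of_notMem (by simp)
      rwa [this]
    · intro j T hj _ ih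
      refine step _ _ j ih (fun i hi => ?_) (mix_of_notMem hj) (mix_of_mem (by simp))
      by_cases h : i ∈ T
      · rw [mix_of_mem h, mix_of_mem (by simp [h])]
      · rw [mix_of_notMem h, mix_of_notMem (by simp [h, hi])]
  have : mix Set.univ R' R = R' := funext fun i => mix_of_mem (by simp)
  simpa [this] using key Set.univ

/-- All agents of `D` are replaced by the single-dipped preferences given by `V`. -/
noncomputable def dipVote (R : Profile α A) (V : N → {P : Pref α // SingleDipped P}) :
    Profile α A := open Classical in
  fun i => if h : i ∈ A then R i else ⟨(V i).1, fun h' => absurd h' h, fun _ => (V i).2⟩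

theorem dipVote_of_mem (R : Profile α A) (V : N → {P : Pref α // SingleDipped P}) {i : N}
    (h : i ∈ A) : dipVote R V i = R i := dif_pos h

theorem dipVote_of_notMem (R : Profile α A) (V : N → {P : Pref α // SingleDipped P}) {i : N}
    (h : i ∉ A) : (dipVote R V i).1 = (V i).1 := by
  simp [dipVote, h]

/-- Unanimous vote `dipLeft δ` of the agents of `D`. -/
noncomputable def voteLeft (R : Profile α A) (δ : α) : Profile α A :=
  dipVote R fun _ => ⟨dipLeft δ, singleDipped_dipLeft δ⟩

/-- Unanimous vote `dipRight δ` of the agents of `D`. -/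
noncomputable def voteRight (R : Profile α A) (δ : α) : Profile α A :=
  dipVote R fun _ => ⟨dipRight δ, singleDipped_dipRight δ⟩

theorem dipVote_congr {R R' : Profile α A} (V : N → {P : Pref α // SingleDipped P}) {j : N}
    (h : ∀ i, i ≠ j → R' i = R i) : ∀ i, i ≠ j → dipVote R' V i = dipVote R V i := by
  intro i hi
  by_cases hA : i ∈ A
  · rw [dipVote_of_mem _ _ hA, dipVote_of_mem _ _ hA, h i hi]
  · exact Subtype.ext (by rw [dipVote_of_notMem _ _ hA, dipVote_of_notMem _ _ hA])

variable {f : Profile α A → α}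

theorem StrategyProof.rel (hf : StrategyProof f) {R R' : Profile α A} (j : N)
    (h : ∀ i, i ≠ j → R' i = R i) : (R j).1.rel (f R) (f R') := by
  apply Pref.rel_of_not_strict
  intro hs
  exact hf j ⟨R, R', fun i hi => h i (by simpa using hi), fun i hi => by
    rw [Set.mem_singleton_iff] at hi
    rwa [hi]⟩

/-- Agents sharing the preference `P` cannot jointly improve according to `P`. -/
theorem StrategyProof.rel_of_common [Finite N] (hf : StrategyProof f) {R R' : Profile α A}
    (P : Pref α) (h : ∀ i, R i = R' i ∨ (R i).1 = P) : P.rel (f R) (f R') := by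
  refine profile_walk (motive := fun Q => P.rel (f R) (f Q)) (R := R) (R' := R') (P.refl _) ?_
  intro Q Q' j hQ hj h1 h2
  rcases h j with h | h
  · have : Q' = Q := by
      funext i
      by_cases hi : i = j
      · rw [hi, h1, h2, h]
      · exact hj i hi
    rwa [this]
  · have := hf.rel j hj
    rw [h1, h] at this
    exact P.transitive _ _ _ hQ this

/-- Maskin monotonicity. -/
theorem StrategyProof.monotonic [Finite N] (hf : StrategyProof f) {R R' : Profile α A}
    (h : ∀ i, R' i = R i ∨ ∀ y ∈ Set.range f, (R' i).1.rel y (f R) → (R i).1.rel y (f R)) :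
    f R' = f R := by
  refine profile_walk (motive := fun Q => f Q = f R) (R := R) (R' := R') rfl ?_
  intro Q Q' j hQ hj h1 h2
  rcases h j with h | h
  · have : Q' = Q := by
      funext i
      by_cases hi : i = j
      · rw [hi, h1, h2, h]
      · exact hj i hi
    rwa [this]
  · have a1 := hf.rel j hj
    have a2 := hf.rel (R := Q') (R' := Q) j (fun i hi => (hj i hi).symm)
    rw [h2, hQ] at a2
    rw [h1, hQ] at a1
    exact Pref.antisymmetric _ _ _ (h _ ⟨_, rfl⟩ a2) a1

/-- The outcomes that the agents of `D` can bring about when those of `A` follow `R`. -/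
def options (f : Profile α A → α) (R : Profile α A) : Set α :=
  {o | ∃ R' : Profile α A, (∀ i ∈ A, R' i = R i) ∧ f R' = o}

theorem dipVote_mem_options (R : Profile α A) (V : N → {P : Pref α // SingleDipped P}) :
    f (dipVote R V) ∈ options f R := ⟨_, fun _ h => dipVote_of_mem R V h, rfl⟩

theorem apply_mem_options (f : Profile α A → α) (R : Profile α A) : f R ∈ options f R :=
  ⟨R, fun _ _ => rfl, rfl⟩

theorem options_subset (R : Profile α A) : options f R ⊆ Set.range f := by
  rintro _ ⟨Q, _, rfl⟩
  exact ⟨Q, rfl⟩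

variable [Finite N]

theorem StrategyProof.voteLeft_rel (hf : StrategyProof f) (R : Profile α A) (δ : α) {o : α}
    (ho : o ∈ options f R) : (dipLeft δ).rel (f (voteLeft R δ)) o := by
  obtain ⟨Q, hQ, rfl⟩ := ho
  refine hf.rel_of_common _ fun i => ?_
  by_cases h : i ∈ A
  · exact .inl ((dipVote_of_mem _ _ h).trans (hQ i h).symm)
  · exact .inr (dipVote_of_notMem _ _ h)

theorem StrategyProof.voteRight_rel (hf : StrategyProof f) (R : Profile α A) (δ : α) {o : α}
    (ho : o ∈ options f R) : (dipRight δ).rel (f (voteRight R δ)) o := by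
  obtain ⟨Q, hQ, rfl⟩ := ho
  refine hf.rel_of_common _ fun i => ?_
  by_cases h : i ∈ A
  · exact .inl ((dipVote_of_mem _ _ h).trans (hQ i h).symm)
  · exact .inr (dipVote_of_notMem _ _ h)

/-- The agents of `D` never have three options. -/
theorem StrategyProof.not_three_options (hf : StrategyProof f) {R : Profile α A} {a b c : α}
    (ha : a ∈ options f R) (hb : b ∈ options f R) (hc : c ∈ options f R) (hab : a < b)
    (hbc : b < c) : False := by
  classical
  obtain ⟨Q, hQA, hQ⟩ := hb
  have hex : ∀ i, ∃ δ : α, i ∉ A →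
      ∀ x y : α, (x ≤ δ ∧ y < x) ∨ (δ ≤ x ∧ x < y) → (Q i).1.strict y x := by
    intro i
    by_cases h : i ∈ A
    · exact ⟨a, fun h' => absurd h h'⟩
    · obtain ⟨δ, hδ⟩ := (Q i).2.2 h
      exact ⟨δ, fun _ => hδ⟩
  choose δ hδ using hex
  -- The agents of `D` act as two blocs, according to whether their dip at Q is at least b; `h2` is
  -- the resulting two-voter rule.
  let W : {P : Pref α // SingleDipped P} → {P : Pref α // SingleDipped P} →
    N → {P : Pref α // SingleDipped P} := fun P P' i => if b ≤ δ i then P else P'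
  let h2 := fun P P' => f (dipVote R (W P P'))
  have sp1 : ∀ P P' P'' : {P : Pref α // SingleDipped P}, P.1.rel (h2 P P') (h2 P'' P') := by
    intro P P' P''
    refine hf.rel_of_common _ fun i => ?_
    by_cases h : i ∈ A
    · exact .inl (by rw [dipVote_of_mem _ _ h, dipVote_of_mem _ _ h])
    · by_cases h' : b ≤ δ i
      · exact .inr (by rw [dipVote_of_notMem _ _ h]; simp [W, h'])
      · exact .inl (Subtype.ext (by
          rw [dipVote_of_notMem _ _ h, dipVote_of_notMem _ _ h]; simp [W, h']))
  have sp2 : ∀ P P' P'' : {P : Pref α // SingleDipped P}, P'.1.rel (h2 P P') (h2 P P'') := by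
    intro P P' P''
    refine hf.rel_of_common _ fun i => ?_
    by_cases h : i ∈ A
    · exact .inl (by rw [dipVote_of_mem _ _ h, dipVote_of_mem _ _ h])
    · by_cases h' : b ≤ δ i
      · exact .inl (Subtype.ext (by
          rw [dipVote_of_notMem _ _ h, dipVote_of_notMem _ _ h]; simp [W, h']))
      · exact .inr (by rw [dipVote_of_notMem _ _ h]; simp [W, h'])
  have hmem : ∀ P P', h2 P P' ∈ options f R := fun P P' => dipVote_mem_options _ _
  let dl : α → {P : Pref α // SingleDipped P} := fun δ => ⟨dipLeft δ, singleDipped_dipLeft δ⟩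
  let dr : α → {P : Pref α // SingleDipped P} := fun δ => ⟨dipRight δ, singleDipped_dipRight δ⟩
  have hl : ∀ o ∈ options f R, (dipLeft c).rel (h2 (dl c) (dl c)) o := by
    intro o ho
    have := hf.voteLeft_rel R c ho
    simpa [h2, W, dl, voteLeft] using this
  have hr : ∀ o ∈ options f R, (dipRight a).rel (h2 (dr a) (dr a)) o := by
    intro o ho
    have := hf.voteRight_rel R a ho
    simpa [h2, W, dr, voteRight] using this
  -- Under `dipLeft c` only alternatives up to b are at least as good as b, and a dip at or after b
  -- already ranks these so; symmetrically for `dipRight a`. Monotonicity therefore keeps the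
  -- outcome b.
  have hlr : h2 (dl c) (dr a) = b := by
    rw [← hQ]
    refine hf.monotonic fun i => ?_
    by_cases h : i ∈ A
    · exact .inl ((dipVote_of_mem _ _ h).trans (hQA i h).symm)
    · right
      intro y _
      rw [dipVote_of_notMem _ _ h, hQ]
      have hi := hδ i h b y
      rcases eq_or_ne y b with rfl | hy
      · exact fun _ => Pref.refl _ _
      · by_cases h' : b ≤ δ i
        · simp only [W, h', dl, if_true, dipLeft_rel]
          intro h3
          exact (hi (.inl ⟨h', by grind⟩)).1
        · simp only [W, h', dr, if_false, dipRight_rel]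
          intro h3
          exact (hi (.inr ⟨by grind, by grind⟩)).1
  -- Let m ≤ a and M ≥ c be the outcomes of the unanimous votes `dl c` and `dr a`. From (`dl c`, `dr
  -- a`), a switch of the first bloc to `dl b` leads from b to M, and the second bloc's switch to
  -- `dr b` then keeps M. If the second bloc switches first, b becomes m. So at (`dl b`, `dr b`) the
  -- first bloc could replace M by the better m.
  have e1 := sp1 (dl b) (dr a) (dr a)
  have e2 := sp1 (dl c) (dr a) (dl b)
  have e3 := sp1 (dl b) (dl c) (dl c)
  have e4 := sp2 (dl b) (dr b) (dr a)
  have e5 := sp2 (dl c) (dr b) (dl c)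
  have e6 := sp2 (dl c) (dr a) (dr b)
  have e7 := sp1 (dl b) (dr b) (dl c)
  rw [hlr] at e2 e6
  have m1 := hl a ha
  have m2 := hr c hc
  have m3 := hr _ (hmem (dl b) (dr a))
  have m4 := hr _ (hmem (dl b) (dr b))
  simp only [dl, dr, dipLeft_rel, dipRight_rel] at *
  have q1 : h2 (dl b) (dr a) = h2 (dr a) (dr a) := by simp only [dl, dr]; grind
  have q2 : h2 (dl b) (dr b) = h2 (dr a) (dr a) := by simp only [dl, dr] at *; grind
  have q3 : h2 (dl c) (dr b) = h2 (dl c) (dl c) := by simp only [dl, dr] at *; grind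
  simp only [dl, dr] at *
  grind

end Profiles

/-! ### Reversal of the order, which exchanges left and right. -/

section Duality

variable {α : Type*} [LinearOrder α] {N : Type*} {A : Set N}

open OrderDual

/-- A profile read in the reversed order of the alternatives. -/
def Profile.dual (R : Profile α A) : Profile αᵒᵈ A := fun i =>
  ⟨⟨fun x y => (R i).1.rel (ofDual x) (ofDual y), fun _ _ => (R i).1.complete _ _,
    fun _ _ _ => (R i).1.transitive _ _ _, fun _ _ => (R i).1.antisymmetric _ _⟩,
    fun h => let ⟨ρ, hρ⟩ := (R i).2.1 h; ⟨toDual ρ, fun x y h => hρ (ofDual x) (ofDual y) h.symm⟩,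
    fun h => let ⟨ρ, hρ⟩ := (R i).2.2 h; ⟨toDual ρ, fun x y h => hρ (ofDual x) (ofDual y) h.symm⟩⟩

/-- A profile for the reversed order read in the original order of the alternatives. -/
def Profile.undual (R : Profile αᵒᵈ A) : Profile α A := fun i =>
  ⟨⟨fun x y => (R i).1.rel (toDual x) (toDual y), fun _ _ => (R i).1.complete _ _,
    fun _ _ _ => (R i).1.transitive _ _ _, fun _ _ => (R i).1.antisymmetric _ _⟩,
    fun h => let ⟨ρ, hρ⟩ := (R i).2.1 h; ⟨ofDual ρ, fun x y h => hρ (toDual x) (toDual y) h.symm⟩,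
    fun h => let ⟨ρ, hρ⟩ := (R i).2.2 h; ⟨ofDual ρ, fun x y h => hρ (toDual x) (toDual y) h.symm⟩⟩

/-- A rule read in the reversed order of the alternatives. -/
def dualRule (f : Profile α A → α) : Profile αᵒᵈ A → αᵒᵈ := fun R => toDual (f R.undual)

theorem Profile.undual_apply_eq {R R' : Profile αᵒᵈ A} {i : N} (h : R i = R' i) :
    R.undual i = R'.undual i := by
  exact Subtype.ext (by simp only [Profile.undual, h])

theorem Profile.dual_apply_eq {R R' : Profile α A} {i : N} (h : R i = R' i) :
    R.dual i = R'.dual i := by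
  exact Subtype.ext (by simp only [Profile.dual, h])

theorem StrategyProof.dual {f : Profile α A → α} (hf : StrategyProof f) :
    StrategyProof (dualRule f) := by
  rintro i ⟨R, R', h, h'⟩
  exact hf i ⟨R.undual, R'.undual, fun j hj => Profile.undual_apply_eq (h j hj), fun j hj => h' j hj⟩

theorem options_dualRule {f : Profile α A → α} (R : Profile α A) {x : α}
    (hx : x ∈ options f R) : toDual x ∈ options (dualRule f) R.dual := by
  obtain ⟨Q, hQ, rfl⟩ := hx
  exact ⟨Q.dual, fun i hi => Profile.dual_apply_eq (hQ i hi), rfl⟩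

theorem options_undual {f : Profile α A → α} {R : Profile αᵒᵈ A} {x : αᵒᵈ}
    (hx : x ∈ options (dualRule f) R) : ofDual x ∈ options f R.undual := by
  obtain ⟨Q, hQ, rfl⟩ := hx
  exact ⟨Q.undual, fun i hi => Profile.undual_apply_eq (hQ i hi), rfl⟩

end Duality

/-! ### The two options of `D` are neighbours in the range. -/

section Contiguity

variable {α : Type*} [LinearOrder α] {N : Type*} {A : Set N} {f : Profile α A → α}

theorem exists_replace (Q : Profile α A) {j : N} (hj : j ∈ A) {P : Pref α} (hP : SinglePeaked P) :
    ∃ Q' : Profile α A, (∀ i, i ≠ j → Q' i = Q i) ∧ (Q' j).1 = P := by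
  classical
  let v : PrefDomain α A j := ⟨P, fun _ => hP, fun h => absurd hj h⟩
  have hv : Function.update Q j v j = v := Function.update_self _ _ _
  exact ⟨Function.update Q j v, fun i hi => Function.update_of_ne hi _ _,
    congrArg Subtype.val hv⟩

variable [Finite N]

/-- Start from a profile with outcome z and give the agents of `A` their preferences from Q. As z is
their top element of the range, monotonicity preserves the outcome. -/
theorem StrategyProof.mem_options_of_peaks (hf : StrategyProof f) {Q : Profile α A} {z : α}
    (hz : z ∈ Set.range f) (hQ : ∀ i ∈ A, (Q i).1.HasPeakOn (Set.range f) z) :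
    z ∈ options f Q := by
  obtain ⟨R, rfl⟩ := hz
  refine ⟨mix A Q R, fun i hi => mix_of_mem hi, hf.monotonic fun i => ?_⟩
  by_cases hi : i ∈ A
  · right
    intro y hy h
    rw [mix_of_mem hi] at h
    by_contra hn
    have hne : y ≠ f R := by
      rintro rfl
      exact hn (Pref.refl _ _)
    exact (hQ i hi y hy hne).2 h
  · exact .inl (mix_of_notMem hi)

/-- Agent j moves to `peakLeft z`, and the options are probed by unanimous votes of `D` before and
after. Strategy-proofness of j in both directions confines how each probe can move. -/
theorem StrategyProof.straddle_step_of_strict (hf : StrategyProof f) {Q : Profile α A} {j : N}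
    (hj : j ∈ A) {x y z : α} (hx : x ∈ options f Q) (hy : y ∈ options f Q) (hxz : x < z)
    (hzy : z < y) (hxy : (Q j).1.strict x y) :
    ∃ Q' : Profile α A, (∀ i, i ≠ j → Q' i = Q i) ∧ (Q' j).1.HasPeakOn Set.univ z ∧
      ∃ x' ∈ options f Q', ∃ y' ∈ options f Q', x' < z ∧ z < y' := by
  obtain ⟨Q', hQ', hP⟩ := exists_replace Q hj (singlePeaked_peakLeft z)
  refine ⟨Q', hQ', hP ▸ peakLeft_hasPeakOn _ _, ?_⟩
  have h3 := fun a b c => hf.not_three_options (R := Q) (a := a) (b := b) (c := c)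
  have h3' := fun a b c => hf.not_three_options (R := Q') (a := a) (b := b) (c := c)
  have move : ∀ V, (Q j).1.rel (f (dipVote Q V)) (f (dipVote Q' V)) ∧
      (peakLeft z).rel (f (dipVote Q' V)) (f (dipVote Q V)) := by
    intro V
    have e1 := hf.rel j (dipVote_congr V hQ')
    have e2 := hf.rel j (fun i hi => (dipVote_congr V hQ' i hi).symm)
    rw [dipVote_of_mem _ _ hj] at e1 e2
    exact ⟨e1, hP ▸ e2⟩
  have better : ∀ w, x ≤ w → w < y → (Q j).1.strict w y :=
    fun w => ((Q j).2.1 hj).strict_of_mem_Ico hxy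
  have m := fun (R : Profile α A) (V : N → {P : Pref α // SingleDipped P}) =>
    dipVote_mem_options (f := f) R V
  -- The only options at Q are x and y, so the votes `dipLeft y` and `dipLeft z` yield x, and
  -- `dipRight x` yields y.
  have l1 : f (voteLeft Q y) = x := by
    have := hf.voteLeft_rel Q y hx
    have hm : f (voteLeft Q y) ∈ options f Q := m _ _
    rw [dipLeft_rel] at this
    grind
  have r1 : f (voteRight Q x) = y := by
    have := hf.voteRight_rel Q x hy
    have hm : f (voteRight Q x) ∈ options f Q := m _ _
    rw [dipRight_rel] at this
    grind
  have c1 : f (voteLeft Q z) = x := by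
    have := hf.voteLeft_rel Q z hx
    have hm : f (voteLeft Q z) ∈ options f Q := m _ _
    rw [dipLeft_rel] at this
    grind
  obtain ⟨l2, l3⟩ : (Q j).1.rel (f (voteLeft Q y)) (f (voteLeft Q' y)) ∧
      (peakLeft z).rel (f (voteLeft Q' y)) (f (voteLeft Q y)) := move _
  obtain ⟨r2, r3⟩ : (Q j).1.rel (f (voteRight Q x)) (f (voteRight Q' x)) ∧
      (peakLeft z).rel (f (voteRight Q' x)) (f (voteRight Q x)) := move _
  have c3 : (peakLeft z).rel (f (voteLeft Q' z)) (f (voteLeft Q z)) := (move _).2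
  have hu : f (voteLeft Q' y) ∈ options f Q' := m _ _
  have hv : f (voteRight Q' x) ∈ options f Q' := m _ _
  have hw : f (voteLeft Q' z) ∈ options f Q' := m _ _
  have uv := hf.voteLeft_rel Q' y hv
  have wu := hf.voteLeft_rel Q' z hu
  have wv := hf.voteLeft_rel Q' z hv
  rw [l1] at l2 l3
  rw [r1] at r2 r3
  rw [c1] at c3
  simp only [peakLeft_rel, dipLeft_rel] at l3 r3 c3 uv wu wv
  generalize f (voteLeft Q' y) = u at *
  generalize f (voteRight Q' x) = v at *
  generalize f (voteLeft Q' z) = w at *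
  -- Such a v is strictly better than y for the original preference of j, who would report `peakLeft
  -- z`. An outcome v < x is excluded by u ≥ x, because u is the vote `dipLeft y` among options
  -- including v.
  have hv1 : ¬ (x ≤ v ∧ v < y) := fun h => (better v h.1 h.2).2 r2
  have hv2 : v = y := by grind
  subst hv2
  refine ⟨u, hu, v, hv, ?_, hzy⟩
  by_contra hn
  -- If u = z, the options at Q' are z and y, and `dipLeft z` elects y. But before the change this
  -- vote gave x, which j with `peakLeft z` prefers to y.
  have hu2 : u = z := by grind
  subst hu2
  have hwy : w = v := by grind
  grind

theorem StrategyProof.straddle_step (hf : StrategyProof f) {Q : Profile α A} {j : N}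
    (hj : j ∈ A) {x y z : α} (hx : x ∈ options f Q) (hy : y ∈ options f Q) (hxz : x < z)
    (hzy : z < y) :
    ∃ Q' : Profile α A, (∀ i, i ≠ j → Q' i = Q i) ∧ (Q' j).1.HasPeakOn Set.univ z ∧
      ∃ x' ∈ options f Q', ∃ y' ∈ options f Q', x' < z ∧ z < y' := by
  rcases (Q j).1.complete x y with h | h
  · exact hf.straddle_step_of_strict hj hx hy hxz hzy
      (Pref.strict_of_rel_of_ne _ h (hxz.trans hzy).ne)
  · obtain ⟨Q', h1, h2, x', hx', y', hy', h3, h4⟩ :=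
      hf.dual.straddle_step_of_strict (Q := Q.dual) hj (z := OrderDual.toDual z)
        (options_dualRule Q hy) (options_dualRule Q hx) hzy hxz
        (Pref.strict_of_rel_of_ne _ h (hxz.trans hzy).ne')
    exact ⟨Q'.undual, fun i hi => Profile.undual_apply_eq (h1 i hi),
      fun w _ hw => h2 (OrderDual.toDual w) trivial hw, _, options_undual hy', _,
      options_undual hx', h4, h3⟩

/-- Two options of the agents of `D` are contiguous in the range of the rule. -/
theorem StrategyProof.options_contiguous (hf : StrategyProof f) {R : Profile α A} {x y z : α}
    (hx : x ∈ options f R) (hy : y ∈ options f R) (hz : z ∈ Set.range f) :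
    ¬ (x < z ∧ z < y) := by
  rintro ⟨hxz, hzy⟩
  have key : ∀ T : Set N, T ⊆ A → ∃ Q : Profile α A, (∀ i ∈ T, (Q i).1.HasPeakOn Set.univ z) ∧
      ∃ x' ∈ options f Q, ∃ y' ∈ options f Q, x' < z ∧ z < y' := by
    intro T
    refine Set.Finite.induction_on (motive := fun T _ => T ⊆ A → ∃ Q : Profile α A,
      (∀ i ∈ T, (Q i).1.HasPeakOn Set.univ z) ∧
      ∃ x' ∈ options f Q, ∃ y' ∈ options f Q, x' < z ∧ z < y') T (Set.toFinite T) ?_ ?_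
    · exact fun _ => ⟨R, by simp, x, hx, y, hy, hxz, hzy⟩
    · intro j T hjT _ ih hT
      obtain ⟨Q, hQ, x', hx', y', hy', h1, h2⟩ := ih ((Set.subset_insert _ _).trans hT)
      obtain ⟨Q', hQ', hj, h⟩ := hf.straddle_step (hT (Set.mem_insert _ _)) hx' hy' h1 h2
      refine ⟨Q', fun i hi => ?_, h⟩
      by_cases hij : i = j
      · exact hij ▸ hj
      · rw [hQ' i hij]
        exact hQ i (by simpa [hij] using hi)
  obtain ⟨Q, hQ, x', hx', y', hy', h1, h2⟩ := key A subset_rfl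
  exact hf.not_three_options hx'
    (hf.mem_options_of_peaks hz fun i hi w _ => hQ i hi w trivial) hy' h1 h2

end Contiguity

/-! ### Only the peaks of `A` matter, and the outcome is monotone in them. -/

section Peaks

variable {α : Type*} [LinearOrder α] {N : Type*} {A : Set N} {f : Profile α A → α}

/-- The agents of `A` receive preferences with the peaks `p`, those of `D` keep theirs. -/
noncomputable def peakProfile {Ω : Set α} (p : A → Ω) (R : Profile α A) : Profile α A :=
  open Classical in fun i =>
    if h : i ∈ A then ⟨peakLeft (p ⟨i, h⟩), fun _ => singlePeaked_peakLeft _, fun h' => absurd h h'⟩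
    else R i

theorem peakProfile_of_notMem {Ω : Set α} (p : A → Ω) (R : Profile α A) {i : N} (h : i ∉ A) :
    peakProfile p R i = R i := dif_neg h

theorem isPeakVector_peakProfile {Ω : Set α} (p : A → Ω) (R : Profile α A) :
    IsPeakVector (peakProfile p R) p := by
  intro i y hy hne
  have : (peakProfile p R i).1 = peakLeft (p i : α) := by simp [peakProfile]
  rw [this]
  exact peakLeft_hasPeakOn Ω _ y hy hne

theorem hasPeakOn_unique {P : Pref α} {Ω : Set α} {z z' : α} (hz : z ∈ Ω) (hz' : z' ∈ Ω)
    (h : P.HasPeakOn Ω z) (h' : P.HasPeakOn Ω z') : z = z' := by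
  by_contra hne
  exact (h z' hz' (Ne.symm hne)).asymm (h' z hz hne)

theorem IsPeakVector.unique {Ω : Set α} {R : Profile α A} {p p' : A → Ω} (h : IsPeakVector R p)
    (h' : IsPeakVector R p') : p = p' := by
  funext i
  exact Subtype.ext (hasPeakOn_unique (p i).2 (p' i).2 (h i) (h' i))

/-- Without a best option, two successive strict improvements would produce three options. -/
theorem StrategyProof.exists_best_option [Finite N] (hf : StrategyProof f) (R : Profile α A) (P : Pref α) :
    ∃ o ∈ options f R, ∀ o' ∈ options f R, P.rel o o' := by
  by_contra! hn
  have h : ∀ o ∈ options f R, ∃ o' ∈ options f R, P.strict o' o := by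
    intro o ho
    obtain ⟨o', ho', h⟩ := hn o ho
    exact ⟨o', ho', (P.complete o o').resolve_left h, h⟩
  obtain ⟨b, hb, hba⟩ := h _ (apply_mem_options f R)
  obtain ⟨c, hc, hcb⟩ := h b hb
  have h1 := hba.ne
  have h2 := hcb.ne
  have h3 := (hcb.trans hba).ne
  have ha := apply_mem_options f R
  generalize f R = a at *
  have h4 := fun a b c => hf.not_three_options (R := R) (a := a) (b := b) (c := c)
  rcases lt_or_gt_of_ne h1 with h1 | h1 <;> rcases lt_or_gt_of_ne h2 with h2 | h2 <;>
    rcases lt_or_gt_of_ne h3 with h3 | h3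
  · exact h4 c b a hc hb ha h2 h1
  · exact h4 c b a hc hb ha h2 h1
  · exact h4 b c a hb hc ha h2 h3
  · exact h4 b a c hb ha hc h1 h3
  · exact h4 c a b hc ha hb h3 h1
  · exact h4 a c b ha hc hb h3 h2
  · exact h4 a b c ha hb hc h1 h2
  · exact h4 a b c ha hb hc h1 h2

/-- When all of `A` report P, the outcome is weakly P-better than it would be under any other
reports of `A`. Hence the P-best option of `D` at such a profile is P-best in the whole range. -/
theorem StrategyProof.exists_hasPeakOn [Finite N] (hf : StrategyProof f) {P : Pref α} (hP : SinglePeaked P)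
    (R : Profile α A) : ∃ z ∈ Set.range f, P.HasPeakOn (Set.range f) z := by
  classical
  let Q : Profile α A := fun i =>
    if h : i ∈ A then ⟨P, fun _ => hP, fun h' => absurd h h'⟩ else R i
  have hQ : ∀ i ∈ A, (Q i).1 = P := fun i h => by simp [Q, h]
  obtain ⟨o, ho, hbest⟩ := hf.exists_best_option Q P
  refine ⟨o, options_subset _ ho, fun y hy hne => Pref.strict_of_rel_of_ne _ ?_ (Ne.symm hne)⟩
  obtain ⟨R₀, rfl⟩ := hy
  refine P.transitive _ _ _ (hbest (f (mix A Q R₀)) ⟨_, fun i hi => mix_of_mem hi, rfl⟩) ?_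
  refine hf.rel_of_common P fun i => ?_
  by_cases h : i ∈ A
  · right
    rw [mix_of_mem h, hQ i h]
  · exact .inl (mix_of_notMem h)

theorem StrategyProof.exists_isPeakVector [Finite N] (hf : StrategyProof f) (R : Profile α A) :
    ∃ p : A → Set.range f, IsPeakVector R p := by
  have h : ∀ i : A, ∃ z : Set.range f, (R i).1.HasPeakOn (Set.range f) z := by
    intro i
    obtain ⟨z, hz, h⟩ := hf.exists_hasPeakOn ((R i).2.1 i.2) R
    exact ⟨⟨z, hz⟩, h⟩
  choose p hp using h
  exact ⟨p, hp⟩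

/-- Moves a further agent j to the peak z while a change of i that respects the peak z still carries
the outcome across z. The incentives of j pin down the outcome beyond z; those of i keep the other
outcome strictly below z. -/
theorem StrategyProof.peak_step_of_strict (hf : StrategyProof f) {R R' : Profile α A} {i j : N}
    (hi : i ∈ A) (hj : j ∈ A) (hij : j ≠ i) {z : α} (hz : z ∈ Set.range f)
    (hR : (R i).1.HasPeakOn (Set.range f) z) (hR' : (R' i).1.HasPeakOn (Set.range f) z)
    (hRR' : ∀ k, k ≠ i → R' k = R k) (h1 : f R < z) (h2 : z < f R')
    (hs : (R j).1.strict (f R) (f R')) :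
    ∃ S S' : Profile α A, (∀ k, k ≠ i → S' k = S k) ∧ (∀ k, k ≠ j → S k = R k) ∧
      S' i = R' i ∧ (S j).1.HasPeakOn Set.univ z ∧ f S < z ∧ z < f S' := by
  obtain ⟨S, hS, hSj⟩ := exists_replace R hj (singlePeaked_peakLeft z)
  obtain ⟨S', hS', hSj'⟩ := exists_replace R' hj (singlePeaked_peakLeft z)
  have hSS' : ∀ k, k ≠ i → S' k = S k := by
    intro k hk
    by_cases hkj : k = j
    · exact hkj ▸ Subtype.ext (hSj'.trans hSj.symm)
    · rw [hS k hkj, hS' k hkj, hRR' k hk]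
  refine ⟨S, S', hSS', hS, hS' i hij.symm, hSj ▸ peakLeft_hasPeakOn _ _, ?_⟩
  have a1 := hf.rel j hS
  have a2 := hf.rel j (fun k hk => (hS k hk).symm)
  have b1 := hf.rel j hS'
  have b2 := hf.rel j (fun k hk => (hS' k hk).symm)
  have i1 := hf.rel i hSS'
  have i2 := hf.rel i (fun k hk => (hSS' k hk).symm)
  rw [hSj, peakLeft_rel] at a2
  rw [hSj', peakLeft_rel] at b2
  rw [hRR' j hij] at b1
  rw [hS i hij.symm] at i1
  rw [hS' i hij.symm] at i2
  have better := fun w => ((R j).2.1 hj).strict_of_mem_Ico hs (w := w)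
  have p1 := fun x y hx hy =>
    ((R i).2.1 hi).strict_of_hasPeakOn (x := x) (y := y) hz hx hy hR
  have p2 := fun x y hx hy =>
    ((R' i).2.1 hi).strict_of_hasPeakOn (x := x) (y := y) hz hx hy hR'
  have ms : f S ∈ Set.range f := ⟨S, rfl⟩
  have ms' : f S' ∈ Set.range f := ⟨S', rfl⟩
  have hb : ¬ (f R ≤ f S' ∧ f S' < f R') := fun h => (better _ h.1 h.2).2 b1
  have q1 : f S ≤ z := by grind
  have q2 : ¬ f S' < f S := fun h => (p2 _ _ ms ms' (.inr ⟨q1, h⟩)).2 i2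
  have q3 : z < f S' := by grind
  refine ⟨lt_of_le_of_ne q1 fun h => ?_, q3⟩
  have := hR' _ ms' q3.ne'
  rw [← h] at this
  exact this.2 i2

theorem StrategyProof.peak_step (hf : StrategyProof f) {R R' : Profile α A} {i j : N}
    (hi : i ∈ A) (hj : j ∈ A) (hij : j ≠ i) {z : α} (hz : z ∈ Set.range f)
    (hR : (R i).1.HasPeakOn (Set.range f) z) (hR' : (R' i).1.HasPeakOn (Set.range f) z)
    (hRR' : ∀ k, k ≠ i → R' k = R k) (h1 : f R < z) (h2 : z < f R') :
    ∃ S S' : Profile α A, (∀ k, k ≠ i → S' k = S k) ∧ (∀ k, k ≠ j → S k = R k) ∧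
      S' i = R' i ∧ (S j).1.HasPeakOn Set.univ z ∧ f S < z ∧ z < f S' := by
  rcases (R j).1.complete (f R) (f R') with h | h
  · exact hf.peak_step_of_strict hi hj hij hz hR hR' hRR' h1 h2
      (Pref.strict_of_rel_of_ne _ h (h1.trans h2).ne)
  · have hdual : ∀ Q : Profile α A, (Q i).1.HasPeakOn (Set.range f) z →
        (Q.dual i).1.HasPeakOn (Set.range (dualRule f)) (OrderDual.toDual z) := by
      rintro Q hQ _ ⟨T, rfl⟩ hne
      exact hQ _ ⟨T.undual, rfl⟩ hne
    obtain ⟨Q, hQ⟩ := hz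
    obtain ⟨S, S', e1, e2, e3, e4, e5, e6⟩ := hf.dual.peak_step_of_strict (R := R'.dual)
      (R' := R.dual) hi hj hij (z := OrderDual.toDual z) ⟨Q.dual, hQ⟩ (hdual R' hR') (hdual R hR)
      (fun k hk => Profile.dual_apply_eq (hRR' k hk).symm) h2 h1 (by
        have := Pref.strict_of_rel_of_ne _ h (h1.trans h2).ne'
        rw [← hRR' j hij] at this
        exact this)
    refine ⟨S'.undual, S.undual, fun k hk => Profile.undual_apply_eq (e1 k hk).symm, ?_,
      Profile.undual_apply_eq (e2 i hij.symm), ?_, e6, e5⟩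
    · intro k hk
      by_cases hki : k = i
      · subst hki
        exact Profile.undual_apply_eq e3
      · have := Profile.undual_apply_eq ((e1 k hki).trans (e2 k hk))
        exact this.trans (hRR' k hki)
    · intro w _ hw
      have := e4 (OrderDual.toDual w) trivial hw
      rw [← e1 j hij] at this
      exact this

/-- Bring all other agents of `A` to the peak z. Then z is an option, and a suitable unanimous vote
of `D` yields z after the change of i but something below z before it, so that i would manipulate.
-/
theorem StrategyProof.not_straddle_peak [Finite N] (hf : StrategyProof f) {R R' : Profile α A} {i : N}
    (hi : i ∈ A) {z : α} (hz : z ∈ Set.range f)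
    (hR : (R i).1.HasPeakOn (Set.range f) z) (hR' : (R' i).1.HasPeakOn (Set.range f) z)
    (hRR' : ∀ k, k ≠ i → R' k = R k) (h1 : f R < z) (h2 : z < f R') : False := by
  have key : ∀ T : Set N, T ⊆ A → i ∉ T → ∃ S S' : Profile α A, (∀ k, k ≠ i → S' k = S k) ∧
      S i = R i ∧ S' i = R' i ∧ (∀ k ∈ T, (S k).1.HasPeakOn Set.univ z) ∧ f S < z ∧ z < f S' := by
    intro T
    refine Set.Finite.induction_on (motive := fun T _ => T ⊆ A → i ∉ T → ∃ S S' : Profile α A,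
      (∀ k, k ≠ i → S' k = S k) ∧ S i = R i ∧ S' i = R' i ∧
      (∀ k ∈ T, (S k).1.HasPeakOn Set.univ z) ∧ f S < z ∧ z < f S') T (Set.toFinite T) ?_ ?_
    · exact fun _ _ => ⟨R, R', hRR', rfl, rfl, by simp, h1, h2⟩
    · intro j T hjT _ ih hT hiT
      obtain ⟨S, S', e1, e2, e3, e4, e5, e6⟩ :=
        ih ((Set.subset_insert _ _).trans hT) fun h => hiT (Set.mem_insert_of_mem _ h)
      have hji : j ≠ i := fun h => hiT (h ▸ Set.mem_insert _ _)
      obtain ⟨U, U', g1, g2, g3, g4, g5, g6⟩ := hf.peak_step hi (hT (Set.mem_insert _ _)) hji hz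
        (R := S) (R' := S') (by rwa [e2]) (by rwa [e3]) e1 e5 e6
      refine ⟨U, U', g1, (g2 i hji.symm).trans e2, g3.trans e3, fun k hk => ?_, g5, g6⟩
      by_cases hkj : k = j
      · exact hkj ▸ g4
      · rw [g2 k hkj]
        exact e4 k (hk.resolve_left hkj)
  obtain ⟨S, S', e1, e2, e3, e4, e5, e6⟩ := key (A \ {i}) Set.sdiff_subset (by simp)
  have hS : ∀ k ∈ A, (S k).1.HasPeakOn (Set.range f) z := by
    intro k hk
    by_cases hki : k = i
    · subst hki
      rwa [e2]
    · exact fun w _ => e4 k ⟨hk, hki⟩ w trivial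
  have hS' : ∀ k ∈ A, (S' k).1.HasPeakOn (Set.range f) z := by
    intro k hk
    by_cases hki : k = i
    · subst hki
      rwa [e3]
    · rw [e1 k hki]
      exact hS k hk
  have z' := hf.mem_options_of_peaks hz hS'
  -- At S' the options are z and f S', and `dipLeft (f S')` elects z; at S the same vote yields at
  -- most f S < z.
  have l1 := hf.voteLeft_rel S (f S') (apply_mem_options f S)
  have l2 := hf.voteLeft_rel S' (f S') z'
  have i1 : (S i).1.rel (f (voteLeft S (f S'))) (f (voteLeft S' (f S'))) := by
    have := hf.rel (R := voteLeft S (f S')) (R' := voteLeft S' (f S')) i (dipVote_congr _ e1)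
    rwa [voteLeft, dipVote_of_mem _ _ hi] at this
  have hm : f (voteLeft S' (f S')) ∈ options f S' := dipVote_mem_options _ _
  have hm' := apply_mem_options f S'
  rw [dipLeft_rel] at l1 l2
  have h3 := fun a b c => hf.not_three_options (R := S') (a := a) (b := b) (c := c)
  have q : f (voteLeft S' (f S')) = z := by grind
  rw [q] at i1
  exact (hS i hi _ ⟨_, rfl⟩ (by grind)).2 i1

/-- The outcome depends only on the peak of an agent of `A`. -/
theorem StrategyProof.peak_only [Finite N] (hf : StrategyProof f) {R R' : Profile α A} {i : N}
    (hi : i ∈ A) {z : α} (hz : z ∈ Set.range f)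
    (hR : (R i).1.HasPeakOn (Set.range f) z) (hR' : (R' i).1.HasPeakOn (Set.range f) z)
    (hRR' : ∀ k, k ≠ i → R' k = R k) : f R' = f R := by
  by_contra hne
  have n1 := hf.not_straddle_peak hi hz hR hR' hRR'
  have n2 := hf.not_straddle_peak hi hz hR' hR fun k hk => (hRR' k hk).symm
  -- Both outcomes lie on the same side of z, so both preferences rank the one nearer to z higher.
  have i1 := hf.rel i hRR'
  have i2 := hf.rel i fun k hk => (hRR' k hk).symm
  have m : f R ∈ Set.range f := ⟨R, rfl⟩
  have m' : f R' ∈ Set.range f := ⟨R', rfl⟩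
  have p1 := fun h => (((R i).2.1 hi).strict_of_hasPeakOn hz m' m hR h).2 i1
  have p2 := fun h => (((R' i).2.1 hi).strict_of_hasPeakOn hz m m' hR' h).2 i2
  grind

theorem StrategyProof.eq_of_peaks [Finite N] (hf : StrategyProof f) {R R' : Profile α A}
    {p : A → Set.range f} (hR : IsPeakVector R p) (hR' : IsPeakVector R' p)
    (hD : ∀ i, i ∉ A → R' i = R i) : f R' = f R := by
  refine profile_walk (motive := fun Q => f Q = f R) (R := R) (R' := R') rfl ?_
  intro Q Q' j hQ hj h1 h2
  rw [← hQ]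
  by_cases h : j ∈ A
  · refine hf.peak_only h (p ⟨j, h⟩).2 ?_ ?_ hj
    · exact h1 ▸ hR ⟨j, h⟩
    · exact h2 ▸ hR' ⟨j, h⟩
  · refine congrArg f (funext fun i => ?_)
    by_cases hi : i = j
    · rw [hi, h1, h2, hD j h]
    · exact hj i hi

/-- If the peaks up to `t` stay there, an outcome up to `t` stays up to `t`. -/
theorem StrategyProof.le_of_peaks [Finite N] (hf : StrategyProof f) {R R' : Profile α A}
    {p p' : A → Set.range f} (hR : IsPeakVector R p) (hR' : IsPeakVector R' p')
    (hD : ∀ i, i ∉ A → R' i = R i) {t : α} (hp : ∀ i, (p i : α) ≤ t → (p' i : α) ≤ t)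
    (h : f R ≤ t) : f R' ≤ t := by
  refine profile_walk (motive := fun Q => f Q ≤ t) (R := R) (R' := R') h ?_
  intro Q Q' j hQ hj h1 h2
  by_contra! hlt
  by_cases h : j ∈ A
  · by_cases hjt : (p' ⟨j, h⟩ : α) ≤ t
    -- With the new peak at most t, j may be taken to have `peakLeft`, which ranks every outcome up
    -- to t above every outcome beyond t.
    · obtain ⟨U, hU, hUj⟩ := exists_replace Q' h (singlePeaked_peakLeft (p' ⟨j, h⟩ : α))
      have hU' : f U = f Q' := hf.peak_only h (p' ⟨j, h⟩).2 (h2 ▸ hR' ⟨j, h⟩)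
        (hUj ▸ peakLeft_hasPeakOn _ _) hU
      have := hf.rel (R := U) (R' := Q) j fun i hi => by rw [hU i hi, hj i hi]
      rw [hUj, hU', peakLeft_rel] at this
      grind
    -- Here the old peak is beyond t as well, and `peakRight` makes j gain from the rise of the
    -- outcome.
    · obtain ⟨U, hU, hUj⟩ := exists_replace Q h (singlePeaked_peakRight (p ⟨j, h⟩ : α))
      have hU' : f U = f Q := hf.peak_only h (p ⟨j, h⟩).2 (h1 ▸ hR ⟨j, h⟩)
        (hUj ▸ peakRight_hasPeakOn _ _) hU
      have := hf.rel (R := U) (R' := Q') j fun i hi => by rw [hU i hi, hj i hi]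
      rw [hUj, hU', peakRight_rel] at this
      have := hp ⟨j, h⟩
      grind
  · have : Q' = Q := funext fun i => by
      by_cases hi : i = j
      · rw [hi, h1, h2, hD j h]
      · exact hj i hi
    rw [this] at hlt
    exact absurd hlt hQ.not_gt

/-- With all peaks at w < x, w is an option, so contiguity bounds the outcome by x, and this bound
survives moving the peaks to x. An outcome below x would survive moving them to some v > x, where v
is an option, against contiguity. -/
theorem StrategyProof.eq_of_interior [Finite N] (hf : StrategyProof f) {R : Profile α A} {x : Set.range f}
    (hx : (x : α) ∈ interiorPoints (Set.range f)) (hR : IsPeakVector R fun _ => x) : f R = x := by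
  obtain ⟨hxf, h1, h2⟩ := hx
  obtain ⟨w, hw, hwx⟩ : ∃ w ∈ Set.range f, w < x := by
    by_contra! hn
    exact h1 ⟨hxf, hn⟩
  obtain ⟨v, hv, hxv⟩ : ∃ v ∈ Set.range f, (x : α) < v := by
    by_contra! hn
    exact h2 ⟨hxf, hn⟩
  have mem : ∀ (u : α) (hu : u ∈ Set.range f), u ∈ options f (peakProfile (fun _ => ⟨u, hu⟩) R) :=
    fun u hu => hf.mem_options_of_peaks hu fun i hi =>
      isPeakVector_peakProfile (fun _ : A => (⟨u, hu⟩ : Set.range f)) R ⟨i, hi⟩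
  have wl := isPeakVector_peakProfile (fun _ : A => (⟨w, hw⟩ : Set.range f)) R
  have vl := isPeakVector_peakProfile (fun _ : A => (⟨v, hv⟩ : Set.range f)) R
  have cw := hf.options_contiguous (mem w hw) (apply_mem_options f _) hxf
  have cv := fun a ha => hf.options_contiguous (x := a) ha (mem v hv) hxf
  apply le_antisymm
  · refine hf.le_of_peaks wl hR (fun i hi => (peakProfile_of_notMem _ _ hi).symm)
      (fun _ _ => le_rfl) ?_
    by_contra! hlt
    exact cw ⟨hwx, hlt⟩
  · by_contra! hlt
    have := hf.le_of_peaks hR vl (fun i hi => peakProfile_of_notMem _ _ hi)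
      (fun _ h => absurd h hlt.not_ge) le_rfl
    exact cv _ (apply_mem_options f _) ⟨this.trans_lt hlt, hxv⟩

end Peaks

/-! ### The order `<*` and its relation to peaks and supporters. -/

section Preselections

variable {α : Type*} [LinearOrder α] {Ω : Set α}

/-- The alternative itself, or the left element of a pair. -/
def Presel.left : Presel α → α
  | .single x => x
  | .pair x _ => x

theorem leStar_single_iff (z : α) (β : Presel α) : leStar (.single z) β ↔ z ≤ β.left := by
  cases β with
  | single x => simp [leStar, ltStar, Presel.left, le_iff_eq_or_lt]
  | pair x y => simp [leStar, ltStar, Presel.left]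

theorem single_mem_preselections {x : α} : .single x ∈ preselections Ω ↔ x ∈ Ω := by
  simp [preselections]

theorem pair_mem_preselections {x y : α} : .pair x y ∈ preselections Ω ↔
    x ∈ Ω ∧ y ∈ Ω ∧ x < y ∧ ∀ z ∈ Ω, ¬ (x < z ∧ z < y) := by
  constructor
  · rintro (⟨u, _, h⟩ | ⟨u, hu, v, hv, huv, h, he⟩)
    · cases h
    · cases he
      exact ⟨hu, hv, huv, h⟩
  · rintro ⟨hx, hy, hxy, h⟩
    exact .inr ⟨x, hx, y, hy, hxy, h, rfl⟩

theorem left_mem {β : Presel α} (h : β ∈ preselections Ω) : β.left ∈ Ω := by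
  cases β with
  | single x => exact single_mem_preselections.1 h
  | pair x y => exact (pair_mem_preselections.1 h).1

theorem ltStar_trans {β γ δ : Presel α} (hβ : β ∈ preselections Ω) (hγ : γ ∈ preselections Ω)
    (hδ : δ ∈ preselections Ω) (h : ltStar β γ) (h' : ltStar γ δ) : ltStar β δ := by
  cases β <;> cases γ <;> cases δ <;>
    simp only [single_mem_preselections, pair_mem_preselections, ltStar] at * <;> grind

theorem ltStar_trichotomy {β γ : Presel α} (hβ : β ∈ preselections Ω) (hγ : γ ∈ preselections Ω) :
    ltStar β γ ∨ β = γ ∨ ltStar γ β := by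
  cases β <;> cases γ <;>
    simp only [single_mem_preselections, pair_mem_preselections, ltStar, Presel.single.injEq,
      Presel.pair.injEq] at * <;> grind

theorem not_leStar_of_ltStar {β γ : Presel α} (hβ : β ∈ preselections Ω)
    (hγ : γ ∈ preselections Ω) (h : ltStar β γ) : ¬ leStar γ β := by
  cases β <;> cases γ <;>
    simp only [single_mem_preselections, pair_mem_preselections, ltStar, leStar,
      Presel.single.injEq, Presel.pair.injEq] at * <;> grind

theorem leStar_or_ltStar {β γ : Presel α} (hβ : β ∈ preselections Ω) (hγ : γ ∈ preselections Ω) :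
    leStar β γ ∨ ltStar γ β := by
  rcases ltStar_trichotomy hβ hγ with h | h | h
  · exact .inl (.inr h)
  · exact .inl (.inl h)
  · exact .inr h

theorem leStar_trans {β γ δ : Presel α} (hβ : β ∈ preselections Ω) (hγ : γ ∈ preselections Ω)
    (hδ : δ ∈ preselections Ω) (h : leStar β γ) (h' : leStar γ δ) : leStar β δ := by
  rcases h with rfl | h
  · exact h'
  · rcases h' with rfl | h'
    · exact .inr h
    · exact .inr (ltStar_trans hβ hγ hδ h h')

theorem leStar_antisymm {β γ : Presel α} (hβ : β ∈ preselections Ω) (hγ : γ ∈ preselections Ω)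
    (h : leStar β γ) (h' : leStar γ β) : β = γ := by
  rcases h with h | h
  · exact h
  · exact absurd h' (not_leStar_of_ltStar hβ hγ h)

variable {N : Type*} {A : Set N}

theorem mem_leftCoalition {p : A → Ω} {β : Presel α} {i : A} :
    i ∈ leftCoalition p β ↔ (p i : α) ≤ β.left := leStar_single_iff _ _

theorem IsPeakVector.strict {R : Profile α A} {p : A → Ω} (h : IsPeakVector R p) (i : A) {x y : α}
    (hx : x ∈ Ω) (hy : y ∈ Ω) (hxy : ((p i : α) ≤ x ∧ x < y) ∨ (x ≤ p i ∧ y < x)) :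
    (R i).1.strict x y :=
  ((R i).2.1 i.2).strict_of_hasPeakOn (p i).2 hx hy (h i) hxy

theorem mem_supporters_iff {R : Profile α A} {p : A → Ω} (h : IsPeakVector R p) {x y : α}
    (hxy : .pair x y ∈ preselections Ω) (i : A) :
    (i : N) ∈ supporters R x y ↔ (p i : α) ≤ x := by
  obtain ⟨hx, hy, hlt, hc⟩ := pair_mem_preselections.1 hxy
  constructor
  · intro hs
    by_contra! hn
    have := hc _ (p i).2
    exact hs.asymm (h.strict i hy hx (.inr ⟨by grind, hlt⟩))
  · exact fun hp => h.strict i hx hy (.inl ⟨hp, hlt⟩)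

theorem supporters_inter {R : Profile α A} {p : A → Ω} (h : IsPeakVector R p) {x y : α}
    (hxy : .pair x y ∈ preselections Ω) :
    supporters R x y ∩ A = Subtype.val '' leftCoalition p (.pair x y) := by
  ext i
  constructor
  · rintro ⟨h1, h2⟩
    exact ⟨⟨i, h2⟩, mem_leftCoalition.2 ((mem_supporters_iff h hxy ⟨i, h2⟩).1 h1), rfl⟩
  · rintro ⟨j, hj, rfl⟩
    exact ⟨(mem_supporters_iff h hxy j).2 (mem_leftCoalition.1 hj), j.2⟩

end Preselections

/-! ### The preselection determined by a peak vector. -/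

section Preselects

variable {α : Type*} [LinearOrder α] {N : Type*} {A : Set N} {f : Profile α A → α}

/-- `β` describes the outcomes at the profiles with peaks `p`: always the same one, or exactly
the two elements of a pair. -/
def Preselects (f : Profile α A → α) (p : A → Set.range f) : Presel α → Prop
  | .single x => ∀ R, IsPeakVector R p → f R = x
  | .pair x y => x < y ∧ (∀ R, IsPeakVector R p → f R = x ∨ f R = y) ∧
      (∃ R, IsPeakVector R p ∧ f R = x) ∧ ∃ R, IsPeakVector R p ∧ f R = y

theorem Preselects.leStar_single (R₀ : Profile α A) {p : A → Set.range f} {β : Presel α}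
    (h : Preselects f p β) (t : α) :
    leStar β (.single t) ↔ ∀ R, IsPeakVector R p → f R ≤ t := by
  cases β with
  | single x =>
    rw [leStar_single_iff]
    constructor
    · exact fun hx R hR => (h R hR).trans_le hx
    · intro hall
      have hR := isPeakVector_peakProfile p R₀
      exact (h _ hR).symm.trans_le (hall _ hR)
  | pair x y =>
    obtain ⟨hxy, hall, -, R', hR', rfl⟩ := h
    simp only [leStar, ltStar, reduceCtorEq, false_or]
    constructor
    · intro hy R hR
      rcases hall R hR with h | h <;> grind
    · exact fun h => h R' hR'

variable [Finite N]

theorem StrategyProof.mem_options_iff (hf : StrategyProof f) {p : A → Set.range f}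
    {R : Profile α A} (hR : IsPeakVector R p) {o : α} :
    o ∈ options f R ↔ ∃ R', IsPeakVector R' p ∧ f R' = o := by
  constructor
  · rintro ⟨R', h, rfl⟩
    exact ⟨R', fun i => by rw [h i i.2]; exact hR i, rfl⟩
  · rintro ⟨R', h, rfl⟩
    refine ⟨mix A R R', fun i hi => mix_of_mem hi, hf.eq_of_peaks h (fun i => ?_) fun i hi => ?_⟩
    · rw [mix_of_mem i.2]
      exact hR i
    · exact mix_of_notMem hi

theorem StrategyProof.exists_preselects (hf : StrategyProof f) (R₀ : Profile α A)
    (p : A → Set.range f) : ∃ β, Preselects f p β := by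
  have hR := isPeakVector_peakProfile p R₀
  have h3 := fun a b c => hf.not_three_options (R := peakProfile p R₀) (a := a) (b := b) (c := c)
  by_cases h : ∃ x ∈ options f (peakProfile p R₀), ∃ y ∈ options f (peakProfile p R₀), x < y
  · obtain ⟨x, hx, y, hy, hxy⟩ := h
    refine ⟨.pair x y, hxy, fun R hRp => ?_, (hf.mem_options_iff hR).1 hx,
      (hf.mem_options_iff hR).1 hy⟩
    have ho := (hf.mem_options_iff hR).2 ⟨R, hRp, rfl⟩
    by_contra! hn
    rcases lt_or_gt_of_ne hn.1 with h1 | h1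
    · exact h3 _ _ _ ho hx hy h1 hxy
    · rcases lt_or_gt_of_ne hn.2 with h2 | h2
      · exact h3 _ _ _ hx ho hy h1 h2
      · exact h3 _ _ _ hx hy ho hxy h2
  · refine ⟨.single (f (peakProfile p R₀)), fun R hRp => ?_⟩
    have h1 := (hf.mem_options_iff hR).2 ⟨R, hRp, rfl⟩
    have h2 := apply_mem_options f (peakProfile p R₀)
    push Not at h
    exact le_antisymm (h _ h2 _ h1) (h _ h1 _ h2)

theorem StrategyProof.contiguous_of_peaks (hf : StrategyProof f) {p : A → Set.range f}
    {R R' : Profile α A} (hR : IsPeakVector R p) (hR' : IsPeakVector R' p) {z : α}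
    (hz : z ∈ Set.range f) : ¬ (f R < z ∧ z < f R') :=
  hf.options_contiguous (apply_mem_options f R) ((hf.mem_options_iff hR).2 ⟨R', hR', rfl⟩) hz

theorem StrategyProof.preselects_mem (hf : StrategyProof f) (R₀ : Profile α A)
    {p : A → Set.range f} {β : Presel α} (h : Preselects f p β) :
    β ∈ preselections (Set.range f) := by
  cases β with
  | single x =>
    exact single_mem_preselections.2 ⟨peakProfile p R₀, h _ (isPeakVector_peakProfile p R₀)⟩
  | pair x y =>
    obtain ⟨hxy, -, ⟨R, hR, rfl⟩, ⟨R', hR', rfl⟩⟩ := h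
    exact pair_mem_preselections.2 ⟨⟨R, rfl⟩, ⟨R', rfl⟩, hxy,
      fun z hz => hf.contiguous_of_peaks hR hR' hz⟩

/-- For a pair one outcome up to x suffices, whereas `leStar_single` asks for all outcomes;
contiguity of the pairs makes the difference. -/
theorem StrategyProof.leStar_pair (hf : StrategyProof f) (R₀ : Profile α A)
    {p : A → Set.range f} {β : Presel α} (h : Preselects f p β) {x y : α}
    (hxy : .pair x y ∈ preselections (Set.range f)) :
    leStar β (.pair x y) ↔ ∃ R, IsPeakVector R p ∧ f R ≤ x := by
  have hβ := hf.preselects_mem R₀ h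
  obtain ⟨hx, hy, hlt, hc⟩ := pair_mem_preselections.1 hxy
  cases β with
  | single z =>
    rw [leStar_single_iff]
    constructor
    · intro hz
      have hR := isPeakVector_peakProfile p R₀
      exact ⟨_, hR, (h _ hR).trans_le hz⟩
    · rintro ⟨R, hR, hle⟩
      exact (h R hR).symm.trans_le hle
  | pair u v =>
    obtain ⟨hu, hv, huv, hc'⟩ := pair_mem_preselections.1 hβ
    obtain ⟨-, hall, ⟨R, hR, hRu⟩, -⟩ := h
    simp only [leStar, ltStar, Presel.pair.injEq]
    constructor
    · exact fun h => ⟨R, hR, by grind⟩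
    · rintro ⟨R', hR', hle⟩
      have := hall R' hR'
      have h1 := hc v hv
      have h2 := hc' x hx
      have h3 := hc' y hy
      grind

theorem StrategyProof.leStar_of_coalition_subset (hf : StrategyProof f) (R₀ : Profile α A)
    {p p' : A → Set.range f} {β β' γ : Presel α} (h : Preselects f p β) (h' : Preselects f p' β')
    (hγ : γ ∈ preselections (Set.range f)) (hle : leStar β γ)
    (hsub : leftCoalition p γ ⊆ leftCoalition p' γ) : leStar β' γ := by
  have hp : ∀ i, (p i : α) ≤ γ.left → (p' i : α) ≤ γ.left := fun i hi =>
    mem_leftCoalition.1 (hsub (mem_leftCoalition.2 hi))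
  cases γ with
  | single t =>
    rw [h.leStar_single R₀] at hle
    rw [h'.leStar_single R₀]
    intro R hR
    have hU := isPeakVector_peakProfile p R
    exact hf.le_of_peaks hU hR (fun i hi => (peakProfile_of_notMem p R hi).symm) hp (hle _ hU)
  | pair x y =>
    rw [hf.leStar_pair R₀ h hγ] at hle
    rw [hf.leStar_pair R₀ h' hγ]
    obtain ⟨R, hR, hx⟩ := hle
    have hU := isPeakVector_peakProfile p' R
    exact ⟨_, hU, hf.le_of_peaks hR hU (fun i hi => peakProfile_of_notMem p' R hi) hp hx⟩

/-- Along a walk that keeps the peaks, only agents of `D` can alter the outcome. A switch from x to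
y would need an agent who prefers x before and y after. -/
theorem StrategyProof.eq_left_of_supporters (hf : StrategyProof f) {p : A → Set.range f} {x y : α}
    (h : Preselects f p (.pair x y)) {R R' : Profile α A} (hR : IsPeakVector R p)
    (hR' : IsPeakVector R' p) (hx : f R = x)
    (hsub : ∀ i, i ∉ A → i ∈ supporters R x y → i ∈ supporters R' x y) : f R' = x := by
  refine (profile_walk (motive := fun Q => IsPeakVector Q p ∧ f Q = x) (R := R) (R' := R')
    ⟨hR, hx⟩ ?_).2
  rintro Q Q' j ⟨hQ, hQx⟩ hj h1 h2
  have hQ' : IsPeakVector Q' p := by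
    intro i
    by_cases hi : (i : N) = j
    · subst hi
      exact h2 ▸ hR' i
    · rw [hj i hi]
      exact hQ i
  refine ⟨hQ', ?_⟩
  by_cases hA : j ∈ A
  · rw [← hQx]
    exact hf.peak_only hA (p ⟨j, hA⟩).2 (hQ ⟨j, hA⟩) (hQ' ⟨j, hA⟩) hj
  · rcases h.2.1 Q' hQ' with hq | hq
    · exact hq
    · exfalso
      have i1 := hf.rel j hj
      have i2 := hf.rel j fun i hi => (hj i hi).symm
      rw [hQx, hq, h1] at i1
      rw [hQx, hq, h2] at i2
      exact (hsub j hA (Pref.strict_of_rel_of_ne _ i1 h.1.ne)).2 i2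

end Preselects

/-! ### From strategy-proofness to the two-step form. -/

section StrategyProofToTwoStep

variable {α : Type*} [LinearOrder α] {N : Type*} {A : Set N} {f : Profile α A → α}

/-- The coalitions of `A` whose peaks, when `≤* β`, force a preselection `≤* β`. -/
def forcingCoalitions {Ω : Set α} (ω : (A → Ω) → Presel α) (β : Presel α) : Set (Set A) :=
  {S | β ∈ Set.range ω ∧ ∀ p, S ⊆ leftCoalition p β → leStar (ω p) β}

variable [Finite N] {ω : (A → Set.range f) → Presel α}

/-- By monotonicity in the peaks, one vector preselecting at or before β decides for all vectors
whose left coalition is at least as large. -/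
theorem StrategyProof.mem_forcingCoalitions (hf : StrategyProof f) (R₀ : Profile α A)
    (hω : ∀ p, Preselects f p (ω p)) {β : Presel α} (hβ : β ∈ Set.range ω)
    (p : A → Set.range f) : leftCoalition p β ∈ forcingCoalitions ω β ↔ leStar (ω p) β := by
  refine ⟨fun h => h.2 p subset_rfl, fun h => ⟨hβ, fun p' hp' => ?_⟩⟩
  obtain ⟨q, rfl⟩ := hβ
  exact hf.leStar_of_coalition_subset R₀ (hω p) (hω p') (hf.preselects_mem R₀ (hω q)) h hp'

theorem StrategyProof.isLeftCoalitionSystem (hf : StrategyProof f) (R₀ : Profile α A)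
    (hω : ∀ p, Preselects f p (ω p)) :
    IsLeftCoalitionSystem (Set.range f) (Set.range ω) (forcingCoalitions ω) := by
  classical
  have mem : ∀ β ∈ Set.range ω, β ∈ preselections (Set.range f) := by
    rintro _ ⟨p, rfl⟩
    exact hf.preselects_mem R₀ (hω p)
  have const_mem : ∀ q : Set.range f, ∃ R, IsPeakVector R (fun _ : A => q) ∧ f R = q := by
    intro q
    have hR := isPeakVector_peakProfile (fun _ : A => q) R₀
    exact (hf.mem_options_iff hR).1 (hf.mem_options_of_peaks q.2 fun i hi => hR ⟨i, hi⟩)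
  refine ⟨?_, ?_, ?_, ?_, ?_⟩
  · exact fun β hβ => Set.eq_empty_of_forall_notMem fun S hS => hβ hS.1
  · exact fun β hβ C hC C' hCC' => ⟨hβ, fun p hp => hC.2 p (hCC'.trans hp)⟩
  · intro β hβ γ hγ hlt C hC
    refine ⟨hγ, fun p hp => ?_⟩
    -- Pulling the peaks of C down to β forces a preselection up to β, and this does not enlarge the
    -- coalition to the left of γ.
    let p' : A → Set.range f := fun i => if i ∈ C then ⟨β.left, left_mem (mem β hβ)⟩ else p i
    have h1 : leStar (ω p') β := hC.2 p' fun i hi => by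
      rw [mem_leftCoalition]
      simp [p', hi]
    refine hf.leStar_of_coalition_subset R₀ (hω p') (hω p) (mem γ hγ)
      (leStar_trans (mem _ ⟨p', rfl⟩) (mem β hβ) (mem γ hγ) h1 (.inr hlt)) fun i hi => ?_
    by_cases hiC : i ∈ C
    · exact hp hiC
    · rw [mem_leftCoalition] at hi ⊢
      simpa [p', hiC] using hi
  · intro M hM hMr
    -- The `<*`-maximum is the preselection with all peaks at M. It can attain M but is not `single
    -- M`, so it is the pair ending in M.
    have hmax : ∀ β ∈ Set.range ω, leStar β (ω fun _ => ⟨M, hM.1⟩) := by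
      intro β hβ
      have hc := hω fun _ => ⟨M, hM.1⟩
      obtain ⟨R, hR, hRM⟩ := const_mem ⟨M, hM.1⟩
      have hm := mem _ ⟨fun _ => ⟨M, hM.1⟩, rfl⟩
      refine (leStar_or_ltStar (mem β hβ) hm).resolve_right fun hlt => ?_
      generalize hmdef : ω (fun _ => ⟨M, hM.1⟩) = m at *
      have hβm := mem β hβ
      cases m with
      | single z => exact hMr ⟨_, by rw [hmdef, ← hc R hR, hRM]⟩
      | pair x y =>
        obtain ⟨hx, hy, hxy, -⟩ := pair_mem_preselections.1 hm
        have hyM : M = y := by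
          have h1 := hc.2.1 R hR
          have h2 := hM.2 hy
          simp only at hRM
          grind
        cases β with
        | single z =>
          have hz := single_mem_preselections.1 hβm
          have : z = M := le_antisymm (hM.2 hz) (by simp only [ltStar] at hlt; grind)
          exact hMr (this ▸ hβ)
        | pair u v =>
          obtain ⟨hu, hv, huv, -⟩ := pair_mem_preselections.1 hβm
          have h1 := hM.2 hv
          simp only [ltStar] at hlt
          grind
    refine ⟨_, ⟨fun _ => ⟨M, hM.1⟩, rfl⟩, hmax, ⟨⟨_, rfl⟩, fun p _ => hmax _ ⟨p, rfl⟩⟩, ?_⟩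
    intro β hβ hne hmem
    exact hne (leStar_antisymm (mem β hβ) (mem _ ⟨_, rfl⟩) (hmax β hβ)
      (hmem.2 _ (Set.empty_subset _)))
  · intro hno β hβ hmem
    have bound : ∀ u ∈ Set.range f, ∃ q ∈ Set.range f, u < q := by
      intro u hu
      by_contra! hn
      exact hno ⟨u, hu, hn⟩
    have hβm := mem β hβ
    cases β with
    | single t =>
      obtain ⟨q, hq, hlt⟩ := bound t (single_mem_preselections.1 hβm)
      obtain ⟨R, hR, hRq⟩ := const_mem ⟨q, hq⟩
      have := ((hω _).leStar_single R₀ t).1 (hmem.2 (fun _ => ⟨q, hq⟩) (Set.empty_subset _)) R hR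
      rw [hRq] at this
      exact this.not_gt hlt
    | pair x y =>
      obtain ⟨hx, hy, hxy, -⟩ := pair_mem_preselections.1 hβm
      obtain ⟨q, hq, hlt⟩ := bound y hy
      obtain ⟨R, hR, hRq⟩ := const_mem ⟨q, hq⟩
      obtain ⟨R', hR', hle⟩ := (hf.leStar_pair R₀ (hω _) hβm).1
        (hmem.2 (fun _ => ⟨q, hq⟩) (Set.empty_subset _))
      exact hf.contiguous_of_peaks hR' hR hy ⟨hle.trans_lt hxy, hRq ▸ hlt⟩

theorem StrategyProof.isGeneralizedMedian (hf : StrategyProof f) (R₀ : Profile α A)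
    (hω : ∀ p, Preselects f p (ω p)) :
    IsGeneralizedMedian (Set.range ω) (forcingCoalitions ω) ω := by
  have mem : ∀ β ∈ Set.range ω, β ∈ preselections (Set.range f) := by
    rintro _ ⟨p, rfl⟩
    exact hf.preselects_mem R₀ (hω p)
  intro p β hβ
  rw [hf.mem_forcingCoalitions R₀ hω hβ]
  constructor
  · rintro rfl
    refine ⟨.inl rfl, fun γ hγ hlt => ?_⟩
    rw [hf.mem_forcingCoalitions R₀ hω hγ]
    exact not_leStar_of_ltStar (mem _ hγ) (mem _ hβ) hlt
  · rintro ⟨h | h, hall⟩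
    · exact h
    · exact absurd ((hf.mem_forcingCoalitions R₀ hω ⟨p, rfl⟩ p).2 (.inl rfl)) (hall _ ⟨p, rfl⟩ h)

theorem StrategyProof.isLeftDecisiveVoting (hf : StrategyProof f) (R₀ : Profile α A)
    (hω : ∀ p, Preselects f p (ω p)) {x y : α} (hxy : .pair x y ∈ Set.range ω)
    (hint : Presel.single '' interiorPoints (Set.range f) ⊆ Set.range ω)
    {g : Profile α A → α}
    (hg : ∀ (R : Profile α A) (p : A → Set.range f), IsPeakVector R p → ω p = .pair x y →
      g R = f R) :
    IsLeftDecisiveVoting (forcingCoalitions ω) ω x y g := by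
  classical
  have hmem : .pair x y ∈ preselections (Set.range f) := by
    obtain ⟨p, hp⟩ := hxy
    exact hp ▸ hf.preselects_mem R₀ (hω p)
  obtain ⟨hx, hy, hlt, hc⟩ := pair_mem_preselections.1 hmem
  have hpre : ∀ p, ω p = .pair x y → Preselects f p (.pair x y) := fun p hp => hp ▸ hω p
  -- All supporter sets that elect x, over every peak vector preselecting the pair; monotonicity in
  -- the peaks makes winning independent of the vector.
  let T : Set (Set N) := {C | ∃ R p, IsPeakVector R p ∧ ω p = .pair x y ∧ f R = x ∧
    supporters R x y = C}
  have hmin : ∀ C ∈ T, ∃ C' ⊆ C, Minimal (· ∈ T) C' := fun C hC =>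
    (Set.toFinite T).exists_le_minimal hC
  refine ⟨{C | Minimal (· ∈ T) C}, fun C hC => ⟨hC, fun C' hC' hle => hC.2 hC'.1 hle⟩, ?_, ?_, ?_⟩
  · intro R p hR hp
    rw [hg R p hR hp]
    constructor
    · rintro ⟨C, hC, hsub⟩
      obtain ⟨R₁, p₁, hR₁, hp₁, hx₁, rfl⟩ := hC.1
      have hU := isPeakVector_peakProfile p R₁
      have hUx : f (peakProfile p R₁) = x := by
        have hle := hf.le_of_peaks hR₁ hU (fun i hi => peakProfile_of_notMem p R₁ hi) (t := x)
          (fun i hi => (mem_supporters_iff hR hmem i).1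
            (hsub ((mem_supporters_iff hR₁ hmem i).2 hi))) hx₁.le
        rcases (hpre p hp).2.1 _ hU with h | h
        · exact h
        · exact absurd (h ▸ hle) hlt.not_ge
      refine hf.eq_left_of_supporters (hpre p hp) hU hR hUx fun i hi his => hsub ?_
      change (peakProfile p R₁ i).1.strict x y at his
      rwa [peakProfile_of_notMem p R₁ hi] at his
    · intro hn
      refine ((hpre p hp).2.1 R hR).resolve_left fun hRx => hn ?_
      obtain ⟨C, hC, hCm⟩ := hmin _ ⟨R, p, hR, hp, hRx, rfl⟩
      exact ⟨C, hCm, hC⟩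
  · intro C hC
    obtain ⟨R, p, hR, hp, hRx, rfl⟩ := hC.1
    by_contra hne
    obtain ⟨R', hR', hRy⟩ := (hpre p hp).2.2.2
    refine hlt.ne ((hf.eq_left_of_supporters (hpre p hp) hR hR' hRx fun i hi his => ?_).symm.trans
      hRy)
    exact absurd ⟨i, his, hi⟩ hne
  · intro B hB
    -- Peaks at x on B and at y elsewhere preselect exactly (x, y), since B forces (x, y) but not x.
    -- A minimal winning set inside the supporters at such a profile then has trace B by minimality
    -- of B.
    let p : A → Set.range f := fun i => if i ∈ B then ⟨x, hx⟩ else ⟨y, hy⟩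
    have hpx : ∀ i, (p i : α) ≤ x ↔ i ∈ B := by
      intro i
      by_cases hi : i ∈ B
      · simp [p, hi]
      · simp [p, hi, hlt]
    have hl : ∀ β : Presel α, β.left = x → leftCoalition p β = B := by
      intro β hβ
      ext i
      rw [mem_leftCoalition, hβ, hpx]
    have hle : leStar (ω p) (.pair x y) := hB.1.1.2 p (hl (.pair x y) rfl).ge
    have hnle : ¬ leStar (ω p) (.single x) := by
      intro hle'
      refine hB.1.2 ?_
      -- Outside the range of ω the family of x is empty by convention, so x has to be shown to be
      -- preselected somewhere, also when it is the minimum.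
      have hxr : .single x ∈ Set.range ω := by
        by_cases hxi : x ∈ interiorPoints (Set.range f)
        · exact hint ⟨x, hxi, rfl⟩
        · have hleast : IsLeast (Set.range f) x := by
            by_contra hn
            exact hxi ⟨hx, hn, fun hg => (hg.2 hy).not_gt hlt⟩
          refine ⟨p, leStar_antisymm (Ω := Set.range f) (hf.preselects_mem R₀ (hω p))
            (single_mem_preselections.2 hx) hle' ?_⟩
          rw [leStar_single_iff]
          exact hleast.2 (left_mem (hf.preselects_mem R₀ (hω p)))
      have := (hf.mem_forcingCoalitions R₀ hω hxr p).2 hle'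
      rwa [hl (.single x) rfl] at this
    have hp : ω p = .pair x y := by
      have hm := hf.preselects_mem R₀ (hω p)
      generalize ω p = β at *
      cases β with
      | single z => simp only [leStar, ltStar, reduceCtorEq, Presel.single.injEq] at *; grind
      | pair u v =>
        have := pair_mem_preselections.1 hm
        have h1 := hc v
        simp only [leStar, ltStar, reduceCtorEq, Presel.pair.injEq] at *
        grind
    obtain ⟨R, hR, hRx⟩ := (hpre p hp).2.2.1
    obtain ⟨C, hC, hCm⟩ := hmin _ ⟨R, p, hR, hp, hRx, rfl⟩
    refine ⟨C, hCm, ?_⟩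
    obtain ⟨R₁, p₁, hR₁, hp₁, hx₁, rfl⟩ := hCm.1
    have hB₁ : supporters R x y ∩ A = Subtype.val '' B := by
      rw [supporters_inter hR hmem, hl (.pair x y) rfl]
    rw [supporters_inter hR₁ hmem]
    have hsub : leftCoalition p₁ (.pair x y) ⊆ B := by
      have := Set.inter_subset_inter_left A hC
      rwa [supporters_inter hR₁ hmem, hB₁, Set.image_subset_image_iff Subtype.val_injective] at this
    refine congrArg _ (subset_antisymm hsub (hB.2 ⟨?_, fun h => ?_⟩ hsub))
    · exact (hf.mem_forcingCoalitions R₀ hω hxy p₁).2 (.inl hp₁)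
    · have := h.2 p₁ fun i hi =>
        mem_leftCoalition.2 ((mem_leftCoalition (β := .pair x y)).1 hi)
      rw [hp₁] at this
      simp only [leStar, ltStar, reduceCtorEq, false_or] at this
      exact this.not_gt hlt

theorem StrategyProof.isTwoStepRule (hf : StrategyProof f) (R₀ : Profile α A) :
    IsTwoStepRule f := by
  classical
  choose ω hω using hf.exists_preselects R₀
  choose pk hpk using hf.exists_isPeakVector
  have hint : Presel.single '' interiorPoints (Set.range f) ⊆ Set.range ω := by
    rintro _ ⟨x, hx, rfl⟩
    let c : A → Set.range f := fun _ => ⟨x, hx.1⟩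
    have hall : ∀ R, IsPeakVector R c → f R = x := fun R hR =>
      hf.eq_of_interior (x := ⟨x, hx.1⟩) hx hR
    refine ⟨c, ?_⟩
    have hc := hω c
    generalize ω c = β at *
    cases β with
    | single z =>
      have hR := isPeakVector_peakProfile c R₀
      rw [← hc _ hR, hall _ hR]
    | pair u v =>
      obtain ⟨huv, -, ⟨R, hR, rfl⟩, ⟨R', hR', rfl⟩⟩ := hc
      exact absurd ((hall R hR).trans (hall R' hR').symm) huv.ne
  -- Where the pair is not preselected the value is immaterial; the left element keeps `g` inside
  -- the pair.
  let g : Presel α → Profile α A → α := fun β R => if ω (pk R) = β then f R else β.left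
  have hg : ∀ β R p, IsPeakVector R p → ω p = β → g β R = f R := by
    intro β R p hR hp
    rw [(hR.unique (hpk R) : p = pk R)] at hp
    exact if_pos hp
  refine ⟨ω, Set.range ω, forcingCoalitions ω, g, rfl, hint, ?_, hf.isLeftCoalitionSystem R₀ hω,
    hf.isGeneralizedMedian R₀ hω, ?_, ?_⟩
  · rintro _ ⟨p, rfl⟩
    exact hf.preselects_mem R₀ (hω p)
  · intro x y hxy
    refine ⟨fun R => ?_, hf.isLeftDecisiveVoting R₀ hω hxy hint (hg _)⟩
    by_cases h : ω (pk R) = .pair x y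
    · rw [hg _ R _ (hpk R) h]
      have := hω (pk R)
      rw [h] at this
      exact this.2.1 R (hpk R)
    · exact .inl (if_neg h)
  · refine fun R => ⟨pk R, hpk R, fun x hx => ?_, fun x y h => (hg _ R _ (hpk R) h).symm⟩
    have := hω (pk R)
    rw [hx] at this
    exact this R (hpk R)

end StrategyProofToTwoStep

/-! ### From the two-step form to group strategy-proofness. -/

section TwoStepToGroupStrategyProof

variable {α : Type*} [LinearOrder α] {N : Type*} {A : Set N}

section Median

variable {Ω : Set α} {r : Set (Presel α)} {L : Presel α → Set (Set A)} {ω : (A → Ω) → Presel α}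

/-- The generalized median is `≤* β` exactly if the coalition to the left of `β` is decisive. -/
theorem IsGeneralizedMedian.leStar_iff (hω : IsGeneralizedMedian r L ω) (hr : r = Set.range ω)
    (hpre : r ⊆ preselections Ω) (hL : IsLeftCoalitionSystem Ω r L) {β : Presel α} (hβ : β ∈ r)
    (p : A → Ω) : leStar (ω p) β ↔ leftCoalition p β ∈ L β := by
  have hp : ω p ∈ r := hr ▸ ⟨p, rfl⟩
  obtain ⟨h1, h2⟩ := (hω p _ hp).1 rfl
  constructor
  · rintro (h | h)
    · rwa [← h]
    · refine hL.superset β hβ _ (hL.mono _ hp _ hβ h _ h1) _ fun i hi => ?_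
      exact leStar_trans (single_mem_preselections.2 (p i).2) (hpre hp) (hpre hβ) hi (.inr h)
  · intro h
    exact (leStar_or_ltStar (hpre hp) (hpre hβ)).resolve_right fun hlt => h2 β hβ hlt h

/-- Raising the preselection takes an agent with a peak at or before it. -/
theorem IsGeneralizedMedian.exists_of_ltStar (hω : IsGeneralizedMedian r L ω)
    (hr : r = Set.range ω) (hpre : r ⊆ preselections Ω) (hL : IsLeftCoalitionSystem Ω r L)
    {p p' : A → Ω} (h : ltStar (ω p) (ω p')) :
    ∃ i, p' i ≠ p i ∧ leStar (.single (p i : α)) (ω p) := by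
  by_contra! hn
  have hp : ω p ∈ r := hr ▸ ⟨p, rfl⟩
  have hp' : ω p' ∈ r := hr ▸ ⟨p', rfl⟩
  refine not_leStar_of_ltStar (hpre hp) (hpre hp') h ?_
  rw [hω.leStar_iff hr hpre hL hp]
  refine hL.superset _ hp _ ((hω.leStar_iff hr hpre hL hp p).1 (.inl rfl)) _ fun i hi => ?_
  have : p' i = p i := by
    by_contra hne
    exact hn i hne hi
  change leStar (.single (p' i : α)) (ω p)
  rwa [this]

/-- Lowering the preselection takes an agent with a peak at or beyond it. -/
theorem IsGeneralizedMedian.exists_of_gtStar [Finite A] (hω : IsGeneralizedMedian r L ω)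
    (hr : r = Set.range ω) (hpre : r ⊆ preselections Ω) (hL : IsLeftCoalitionSystem Ω r L)
    (hint : Presel.single '' interiorPoints Ω ⊆ r) {p p' : A → Ω} (h : ltStar (ω p') (ω p)) :
    ∃ i, p' i ≠ p i ∧ ¬ ltStar (.single (p i : α)) (ω p) := by
  by_contra! hn
  have hp : ω p ∈ r := hr ▸ ⟨p, rfl⟩
  have hp' : ω p' ∈ r := hr ▸ ⟨p', rfl⟩
  -- If all changed peaks are before ω p, some γ in r before ω p lies at or after ω p' and all of
  -- them. Then the left coalition of p at γ contains that of p', which forces ω p up to γ.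
  obtain ⟨γ, hγ, hγp, hle, hmax⟩ : ∃ γ ∈ r, ltStar γ (ω p) ∧ leStar (ω p') γ ∧
      ∀ i, p' i ≠ p i → leStar (.single (p i : α)) γ := by
    by_cases hall : ∀ i, p' i ≠ p i → leStar (.single (p i : α)) (ω p')
    · exact ⟨ω p', hp', h, .inl rfl, hall⟩
    · push Not at hall
      obtain ⟨j, hj, hjp⟩ := hall
      obtain ⟨k, hk, hkmax⟩ := (Set.toFinite {i | p' i ≠ p i}).exists_maximalFor
        (fun i => (p i : α)) _ ⟨j, hj⟩
      have hjk : (p j : α) ≤ p k := by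
        by_contra! hlt
        exact hlt.not_ge (hkmax hj hlt.le)
      have hkp : ¬ leStar (.single (p k : α)) (ω p') := fun hk' => hjp (by
        rw [leStar_single_iff] at *
        exact hjk.trans hk')
      have hgt := (leStar_or_ltStar (single_mem_preselections.2 (p k).2) (hpre hp')).resolve_left hkp
      -- The largest changed peak lies after ω p' and before ω p, hence is neither minimum nor
      -- maximum.
      have hkr : Presel.single (p k : α) ∈ r := by
        refine hint ⟨_, ⟨(p k).2, fun hl => ?_, fun hg => ?_⟩, rfl⟩
        · exact hkp ((leStar_single_iff _ _).2 (hl.2 (left_mem (hpre hp'))))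
        · have h1 := hn k hk
          have h2 := hpre hp
          generalize ω p = β at h1 h2
          cases β with
          | single z => exact (hg.2 (single_mem_preselections.1 h2)).not_gt h1
          | pair x y =>
            obtain ⟨hx, hy, hxy, -⟩ := pair_mem_preselections.1 h2
            exact (hg.2 hy).not_gt (lt_of_le_of_lt h1 hxy)
      refine ⟨_, hkr, hn k hk, .inr hgt, fun i hi => ?_⟩
      rw [leStar_single_iff]
      by_contra! hlt
      exact hlt.not_ge (hkmax hi hlt.le)
  refine not_leStar_of_ltStar (hpre hγ) (hpre hp) hγp ?_
  rw [hω.leStar_iff hr hpre hL hγ]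
  refine hL.superset _ hγ _ ((hω.leStar_iff hr hpre hL hγ p').1 hle) _ fun i hi => ?_
  by_cases hip : p' i = p i
  · change leStar (.single (p i : α)) γ
    rwa [← hip]
  · exact hmax i hip

end Median

theorem IsTwoStepRule.groupStrategyProof [Finite N] {f : Profile α A → α}
    (h : IsTwoStepRule f) : GroupStrategyProof f := by
  obtain ⟨ω, r, L, g, hr, hint, hpre, hL, hω, hg, hf⟩ := h
  rintro S ⟨s, hs⟩ ⟨R, R', hRR', hS⟩
  obtain ⟨p, hp, hp1, hp2⟩ := hf R
  obtain ⟨p', hp', hp1', hp2'⟩ := hf R'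
  have hne : f R ≠ f R' := (hS s hs).ne.symm
  have hpS : ∀ i : A, p' i ≠ p i → (i : N) ∈ S := by
    intro i hi
    by_contra hiS
    refine hi (Subtype.ext (hasPeakOn_unique (p' i).2 (p i).2 (hp' i) ?_))
    rw [hRR' i hiS]
    exact hp i
  have hm : f R ∈ Set.range f := ⟨R, rfl⟩
  have hm' : f R' ∈ Set.range f := ⟨R', rfl⟩
  have up : ∀ i : A, (i : N) ∈ S → f R < f R' → f R < p i := by
    intro i hi hlt
    by_contra! hn
    exact (hS i hi).asymm (hp.strict i hm hm' (.inl ⟨hn, hlt⟩))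
  have down : ∀ i : A, (i : N) ∈ S → f R' < f R → (p i : α) < f R := by
    intro i hi hlt
    by_contra! hn
    exact (hS i hi).asymm (hp.strict i hm hm' (.inr ⟨hn, hlt⟩))
  have hωp : ω p ∈ r := hr ▸ ⟨p, rfl⟩
  have hωp' : ω p' ∈ r := hr ▸ ⟨p', rfl⟩
  have value : ∀ (Q : Profile α A) (q : A → Set.range f), ω q ∈ r →
      (∀ x, ω q = .single x → f Q = x) → (∀ x y, ω q = .pair x y → f Q = g (.pair x y) Q) →
      (ω q = .single (f Q)) ∨ ∃ x y, ω q = .pair x y ∧ (f Q = x ∨ f Q = y) := by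
    intro Q q hq h1 h2
    cases hβ : ω q with
    | single x => exact .inl (by rw [h1 x hβ])
    | pair x y =>
      refine .inr ⟨x, y, rfl, ?_⟩
      rw [h2 x y hβ]
      exact (hg x y (hβ ▸ hq)).1 Q
  have v := value R p hωp hp1 hp2
  have v' := value R' p' hωp' hp1' hp2'
  rcases ltStar_trichotomy (hpre hωp) (hpre hωp') with hlt | heq | hlt
  -- The agent found belongs to S and would have to gain from a rise of the outcome, which needs a
  -- peak beyond f R; but that peak is at or before the preselection.
  · obtain ⟨i, hi, hle⟩ := hω.exists_of_ltStar hr hpre hL hlt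
    rw [leStar_single_iff] at hle
    have hle' : f R ≤ f R' := by
      have m := hpre hωp
      have m' := hpre hωp'
      rcases v with v | ⟨x, y, v, hv⟩ <;> rcases v' with v' | ⟨x', y', v', hv'⟩ <;>
        rw [v] at m hlt <;> rw [v'] at m' hlt <;>
        simp only [single_mem_preselections, pair_mem_preselections, ltStar] at * <;> grind
    have hu := up i (hpS i hi) (lt_of_le_of_ne hle' hne)
    have m := hpre hωp
    rcases v with v | ⟨x, y, v, hv⟩ <;> rw [v] at m hle <;>
      simp only [Presel.left, single_mem_preselections, pair_mem_preselections] at * <;> grind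
  · cases hβ : ω p with
    | single x => exact hne ((hp1 x hβ).trans (hp1' x (heq ▸ hβ)).symm)
    | pair x y =>
      have hβ' : ω p' = .pair x y := heq ▸ hβ
      obtain ⟨W, -, hW, -⟩ := (hg x y (hβ ▸ hωp)).2
      have w := hW R p hp hβ
      have w' := hW R' p' hp' hβ'
      rw [← hp2 x y hβ] at w
      rw [← hp2' x y hβ'] at w'
      -- If the outcome moves from x to y, S contains no supporter of x at R, so no support is lost;
      -- if from y to x, all of S supported x already.
      by_cases hC : ∃ C ∈ W, C ⊆ supporters R x y
      · by_cases hC' : ∃ C ∈ W, C ⊆ supporters R' x y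
        · exact hne ((w.1 hC).trans (w'.1 hC').symm)
        · obtain ⟨C, hCW, hsub⟩ := hC
          refine hC' ⟨C, hCW, fun i hi => ?_⟩
          have his := hsub hi
          by_cases hiS : i ∈ S
          · have := hS i hiS
            rw [w.1 ⟨C, hCW, hsub⟩, w'.2 hC'] at this
            exact absurd this his.asymm
          · change (R' i).1.strict x y
            rw [hRR' i hiS]
            exact his
      · by_cases hC' : ∃ C ∈ W, C ⊆ supporters R' x y
        · obtain ⟨C, hCW, hsub⟩ := hC'
          refine hC ⟨C, hCW, fun i hi => ?_⟩
          by_cases hiS : i ∈ S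
          · have := hS i hiS
            rw [w.2 hC, w'.1 ⟨C, hCW, hsub⟩] at this
            exact this
          · have his := hsub hi
            change (R' i).1.strict x y at his
            rw [hRR' i hiS] at his
            exact his
        · exact hne ((w.2 hC).trans (w'.2 hC').symm)
  · obtain ⟨i, hi, hle⟩ := hω.exists_of_gtStar hr hpre hL hint hlt
    have hle' : f R' ≤ f R := by
      have m := hpre hωp
      have m' := hpre hωp'
      rcases v with v | ⟨x, y, v, hv⟩ <;> rcases v' with v' | ⟨x', y', v', hv'⟩ <;>
        rw [v] at m hlt <;> rw [v'] at m' hlt <;>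
        simp only [single_mem_preselections, pair_mem_preselections, ltStar] at * <;> grind
    have hu := down i (hpS i hi) (lt_of_le_of_ne hle' hne.symm)
    have m := hpre hωp
    have hpi := (p i).2
    rcases v with v | ⟨x, y, v, hv⟩ <;> rw [v] at m hle
    · exact hle hu
    · obtain ⟨hx, hy, hxy, hc⟩ := pair_mem_preselections.1 m
      have := hc _ hpi
      simp only [ltStar] at hle
      grind

end TwoStepToGroupStrategyProof

theorem GroupStrategyProof.strategyProof {α : Type*} [LinearOrder α] {N : Type*} {A : Set N}
    {f : Profile α A → α} (h : GroupStrategyProof f) : StrategyProof f :=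
  fun i => h {i} (Set.singleton_nonempty i)

theorem Profile.nonempty {α : Type*} [LinearOrder α] [Nonempty α] {N : Type*} (A : Set N) :
    Nonempty (Profile α A) := by
  classical
  obtain ⟨a⟩ := ‹Nonempty α›
  exact ⟨fun i => if h : i ∈ A then ⟨peakLeft a, fun _ => singlePeaked_peakLeft a, fun h' => absurd h h'⟩
    else ⟨dipLeft a, fun h' => absurd h' h, fun _ => singleDipped_dipLeft a⟩⟩

theorem theorem1 {N : Type*} [Finite N] (A : Set N) (X : Set ℝ) (hX : X.Countable)
    (hne : X.Nonempty) (f : Profile X A → X) :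
    List.TFAE [StrategyProof f, GroupStrategyProof f, IsTwoStepRule f] := by
  have : Nonempty X := hne.to_subtype
  obtain ⟨R₀⟩ := Profile.nonempty (α := X) A
  tfae_have 1 → 3 := fun h => h.isTwoStepRule R₀
  tfae_have 3 → 2 := fun h => h.groupStrategyProof
  tfae_have 2 → 1 := fun h => h.strategyProof
  tfae_finish
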